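/- Let $1\le m<N\le M$, let $A\in\mathbb{R}^{M\times N}$ and $\tau\ge 0$, and let $A=U\Sigma V^T$ be a singular value decomposition with $U=[u_1,\dots,u_M]$ and $V=[v_1,\dots,v_N]$ orthogonal and singular values $\sigma_1,\dots,\sigma_N\ge 0$ labeled so that $|\sigma_1-\tau|\le|\sigma_2-\tau|\le\dots\le|\sigma_N-\tau|$. Let $\sigma_{\max},\sigma_{\min}$ be the largest and the smallest singular value of $A$, and $\sigma_{\max,m+1},\sigma_{\min,m+1}$ the $(m+1)$-th largest and the $(m+1)$-th smallest one, counted with multiplicity. Put $U_m=[u_1,\dots,u_m]$ and $V_m=[v_1,\dots,v_m]$, and let $\widetilde U_m\in\mathbb{R}^{M\times m}$, $\widetilde V_m\in\mathbb{R}^{N\times m}$ have orthonormal columns (the approximate left and right singular vectors). With $$\Pi=\begin{bmatrix} I-\widetilde U_m\widetilde U_m^T&\\&I-\widetilde V_m\widetilde V_m^T\end{bmatrix},\qquad \widetilde B_m=\Pi\begin{bmatrix}-\tau I&A\\A^T&-\tau I\end{bmatrix}\Pi ,$$ let $r\ne 0$ satisfy $\Pi r=r$, and consider the preconditioned correction equation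 $\widetilde B_m w=-r$. For $j\ge 0$ let $\tilde w_j$ be its $j$-th MINRES iterate with initial guess $0$, i.e. a minimizer of $\|\widetilde B_m w+r\|$ over $w\in\mathrm{span}\{r,\widetilde B_m r,\dots,\widetilde B_m^{j-1}r\}$, and let $r_{\mathrm{in},j}=\widetilde B_m\tilde w_j+r$. Let $\Phi$ and $\Psi$ be the diagonal matrices of canonical angles between the column spaces of $\widetilde U_m$ and $U_m$, and of $\widetilde V_m$ and $V_m$, respectively, and let $\|\cdot\|$ be the 2-norm of vectors and matrices. Assume that $$\delta:=\|A\|\,(\|\sin\Phi\|+\|\sin\Psi\|)^2<|\sigma_{m+1}-\tau|.$$ (i) If $\tau>(\sigma_{\max}+\sigma_{\max,m+1})/2$, then $$\frac{\|r_{\mathrm{in},j}\|}{\|r\|}\le 2\Bigg(1-\frac{2}{1+\sqrt{(\tau+\sigma_{\max,m+1}+\delta)/(\tau-\sigma_{\max,m+1}-\delta)}}\Bigg)^{j}.$$ (ii) If $\tau>0$ and $\sigma_{\min}\le\tau<(\sigma_{\min}+\sigma_{\min,m+1})/2$, then, with $j_o=\min\{1,M-N\}$, $$\frac{\|r_{\mathrm{in},j}\|}{\|r\|}\le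 2\left(\frac{\sigma_{\max}+\delta}{\tau}\right)^{j_o}\Bigg(1-\frac{2}{1+\sqrt{\frac{(\sigma_{\max}+\delta)^2-\tau^2}{(\sigma_{\min,m+1}-\delta)^2-\tau^2}}}\Bigg)^{\left[\frac{j-j_o}{2}\right]}.$$ (iii) If $(\sigma_{\min}+\sigma_{\min,m+1})/2<\tau<(\sigma_{\max}+\sigma_{\max,m+1})/2$, then $$\frac{\|r_{\mathrm{in},j}\|}{\|r\|}\le 2\left(1-\frac{2}{1+(\sigma_{\max}+\tau+\delta)/(|\sigma_{m+1}-\tau|-\delta)}\right)^{\left[\frac{j}{2}\right]}.$$ Here $[x]$ is the integer part of $x$, truncated towards zero (so that $[-\tfrac12]=0$), and $0^0=1$. -/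

import Mathlib

open scoped Matrix Matrix.Norms.L2Operator

noncomputable section

namespace JDSVD

/-- The rectangular `M × N` diagonal matrix with diagonal entries `σ`. -/
def rectDiagonal (M : ℕ) {N : ℕ} (σ : Fin N → ℝ) : Matrix (Fin M) (Fin N) ℝ :=
  Matrix.of fun i j => if (i : ℕ) = (j : ℕ) then σ j else 0

/-- `A = U Σ Vᵀ` is a (full) singular value decomposition of `A`; no ordering of the singular
values `σ` is imposed. -/
structure IsSVD {M N : ℕ} (A : Matrix (Fin M) (Fin N) ℝ) (U : Matrix (Fin M) (Fin M) ℝ)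
    (σ : Fin N → ℝ) (V : Matrix (Fin N) (Fin N) ℝ) : Prop where
  left_orthogonal : U ∈ Matrix.orthogonalGroup (Fin M) ℝ
  right_orthogonal : V ∈ Matrix.orthogonalGroup (Fin N) ℝ
  nonneg : ∀ i, 0 ≤ σ i
  eq : A = U * rectDiagonal M σ * Vᵀ

/-- The `(k+1)`-th smallest entry of `σ`, counted with multiplicity. -/
def kthSmallest {N : ℕ} (σ : Fin N → ℝ) (k : Fin N) : ℝ := σ (Tuple.sort σ k)

/-- The `(k+1)`-th largest entry of `σ`, counted with multiplicity. -/
def kthLargest {N : ℕ} (σ : Fin N → ℝ) (k : Fin N) : ℝ := σ (Tuple.sort σ k.rev)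

/-- The matrix made of the first `m` columns of `X`. -/
def firstColumns {n m : ℕ} (h : m ≤ n) (X : Matrix (Fin n) (Fin n) ℝ) :
    Matrix (Fin n) (Fin m) ℝ :=
  X.submatrix id (Fin.castLE h)

/-- The column space of a real matrix, as a subspace of Euclidean space. -/
def columnSpace {n m : ℕ} (X : Matrix (Fin n) (Fin m) ℝ) :
    Submodule ℝ (EuclideanSpace ℝ (Fin n)) :=
  LinearMap.range (Matrix.toEuclideanLin X)

/-- The canonical (principal) angles between two subspaces `F` and `G`, in increasing order: their
cosines are the singular values of the orthogonal projection onto `F` restricted to `G`. For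
`dim F = dim G = m` the `m` canonical angles are those with index `i < m`. -/
def canonicalAngle {n : ℕ} (F G : Submodule ℝ (EuclideanSpace ℝ (Fin n))) (i : ℕ) : ℝ :=
  Real.arccos ((F.orthogonalProjectionOnto ∘L G.subtypeL).toLinearMap.singularValues i)

/-- The sine of the canonical angle matrix `diag(φ₁, …, φₘ)` between two `m`-dimensional
subspaces, i.e. `diag(sin φ₁, …, sin φₘ)`. -/
def sinCanonicalAngles {n : ℕ} (m : ℕ) (F G : Submodule ℝ (EuclideanSpace ℝ (Fin n))) :
    Matrix (Fin m) (Fin m) ℝ :=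
  Matrix.diagonal fun i => Real.sin (canonicalAngle F G i)

/-- The block diagonal projector `diag(I - X Xᵀ, I - Y Yᵀ)`. -/
def deflationProjector {M N m : ℕ} (X : Matrix (Fin M) (Fin m) ℝ) (Y : Matrix (Fin N) (Fin m) ℝ) :
    Matrix (Fin M ⊕ Fin N) (Fin M ⊕ Fin N) ℝ :=
  Matrix.fromBlocks (1 - X * Xᵀ) 0 0 (1 - Y * Yᵀ)

/-- The shifted augmented matrix `[-τ I, A; Aᵀ, -τ I]`. -/
def shiftedAugmented {M N : ℕ} (A : Matrix (Fin M) (Fin N) ℝ) (τ : ℝ) :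
    Matrix (Fin M ⊕ Fin N) (Fin M ⊕ Fin N) ℝ :=
  Matrix.fromBlocks (-(τ • 1)) A Aᵀ (-(τ • 1))

/-- The coefficient matrix of the preconditioned correction equation. -/
def correctionMatrix {M N m : ℕ} (A : Matrix (Fin M) (Fin N) ℝ) (τ : ℝ)
    (X : Matrix (Fin M) (Fin m) ℝ) (Y : Matrix (Fin N) (Fin m) ℝ) :
    Matrix (Fin M ⊕ Fin N) (Fin M ⊕ Fin N) ℝ :=
  deflationProjector X Y * shiftedAugmented A τ * deflationProjector X Y

/-- The Krylov subspace `span {r, B r, …, B ^ (j - 1) r}`. -/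
def krylov {ι : Type} [Fintype ι] [DecidableEq ι] (B : Matrix ι ι ℝ) (r : EuclideanSpace ℝ ι)
    (j : ℕ) : Submodule ℝ (EuclideanSpace ℝ ι) :=
  Submodule.span ℝ (Set.range fun i : Fin j => Matrix.toEuclideanLin (B ^ (i : ℕ)) r)

/-- The residual `B w + r` of `w` for the linear system `B w = -r`. -/
def linResidual {ι : Type} [Fintype ι] [DecidableEq ι] (B : Matrix ι ι ℝ) (r w : EuclideanSpace ℝ ι) :
    EuclideanSpace ℝ ι :=
  Matrix.toEuclideanLin B w + r

/-- `w` is the `j`-th MINRES iterate for the symmetric linear system `B w = -r`, started from the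
zero vector: it minimizes the residual norm over the `j`-th Krylov subspace. -/
def IsMinresIterate {ι : Type} [Fintype ι] [DecidableEq ι] (B : Matrix ι ι ℝ)
    (r : EuclideanSpace ℝ ι) (j : ℕ) (w : EuclideanSpace ℝ ι) : Prop :=
  w ∈ krylov B r j ∧ ∀ w' ∈ krylov B r j, ‖linResidual B r w‖ ≤ ‖linResidual B r w'‖

end JDSVD

end

open JDSVD

/-! By minimality, the MINRES residual is at most `‖q(B) r‖` for every polynomial `q` of degree at
most `j` with `q(0) = 1`. As `B` is symmetric and `r` lies in the range of the projector, only the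
values of `q` at eigenvalues `c` having an eigenvector in that range matter. It remains to locate
these `c` and to choose `q`.

Such a `c` makes `μ = c + τ` an eigenvalue of the compression of `[0, A; Aᵀ, 0]` to the complements
of the approximate singular subspaces. If those subspaces were exact, `|μ|` would be a singular
value with index at least `m` in the given labeling, or zero for the unpaired left vectors when `N <
M`. Otherwise the error is of second order in the angles: a vector orthogonal to the approximate
subspace has an `O(sin)` component in the exact one, `A` carries it into the partner subspace, and
the outer projection contributes another `O(sin)`. The total loss is at most `δ`
(`norm_compression_le`, `le_norm_compression`). When `τ` is interior, `μ` may lie on either side of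
`τ`, so the distance of `μ` from `τ` is bounded below on the pair of blocks at once
(`le_abs_eigenvalue_of_compression`).

The polynomials are Chebyshev polynomials on a positive interval (`exists_polynomial_abs_eval_le`),
composed with a map that vanishes at `c = 0`: `-c` in (i), where all eigenvalues are negative; `(c +
τ)² - τ²` in (ii), which folds the spectrum, symmetric about `-τ`; `c²` in (iii). The two quadratic
maps halve the exponent. In (ii) with `N < M`, a factor `1 + c/τ` removes `μ = 0` at the cost of one
degree. -/

/-! ### Chebyshev residual polynomials -/

open Polynomial in
/-- A shifted and scaled Chebyshev polynomial, normalized at `0`, is small on `[a, b]`. -/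
theorem exists_polynomial_abs_eval_le {a b : ℝ} (ha : 0 < a) (hab : a ≤ b) (k : ℕ) :
    ∃ q : ℝ[X], q.natDegree ≤ k ∧ q.eval 0 = 1 ∧
      ∀ x, a ≤ x → x ≤ b → |q.eval x| ≤ 2 * (1 - 2 / (1 + √(b / a))) ^ k := by
  rcases hab.eq_or_lt with rfl | hlt
  -- The interval is a point and the rate is `0`, so for `k > 0` the polynomial must vanish at `a`.
  · refine ⟨(1 - C a⁻¹ * X) ^ k, ?_, by simp, fun x h1 h2 => ?_⟩
    · refine natDegree_pow_le.trans ?_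
      have h1 : (1 - C a⁻¹ * X : ℝ[X]).natDegree ≤ 1 := by compute_degree
      exact (Nat.mul_le_mul_left k h1).trans (by simp)
    · obtain rfl : x = a := le_antisymm h2 h1
      simp [ha.ne']
      norm_num
      rcases k.eq_zero_or_pos with rfl | hk
      · simp
      · simp [hk.ne']
  · have hb : 0 < b := ha.trans hlt
    set c := (b + a) / (b - a) with hc
    have hba : 0 < b - a := sub_pos.2 hlt
    set s := √(b / a) with hs
    have hs2 : s ^ 2 = b / a := Real.sq_sqrt (by positivity)
    have hs1 : 1 < s := by
      rw [hs]; apply Real.lt_sqrt_of_sq_lt; rw [one_pow, one_lt_div ha]; exact hlt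
    have hsm : 0 < s - 1 := sub_pos.2 hs1
    -- `t` is the root larger than `1` of `t + t⁻¹ = 2c`, and `t⁻¹` is the claimed rate.
    set t := (s + 1) / (s - 1) with ht
    have ht0 : 0 < t := by positivity
    have hct : c = Real.cosh (Real.log t) := by
      rw [Real.cosh_log ht0, ht, hc]
      have hb' : b = a * s ^ 2 := by rw [hs2]; field_simp
      have h1 : s ^ 2 - 1 ≠ 0 := by nlinarith
      have h2 : a * s ^ 2 - a ≠ 0 := by rw [← hb']; exact hba.ne'
      rw [hb']
      have h3 : s + 1 ≠ 0 := by positivity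
      field_simp
      ring
    have hT : (Chebyshev.T ℝ k).eval c = Real.cosh (k * Real.log t) := by
      rw [hct]; exact_mod_cast Chebyshev.T_real_cosh (Real.log t) k
    have hTge : t ^ k / 2 ≤ (Chebyshev.T ℝ k).eval c := by
      rw [hT, Real.cosh_eq, ← Real.log_pow, Real.exp_log (by positivity)]
      have := Real.exp_pos (-Real.log (t ^ k))
      linarith
    have htk : 0 < t ^ k / 2 := by positivity
    have hTpos := htk.trans_le hTge
    -- The affine map sends `a, b` to `1, -1` and `0` to `c`.
    refine ⟨C ((Chebyshev.T ℝ k).eval c)⁻¹ *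
      (Chebyshev.T ℝ k).comp (C c - C (2 / (b - a)) * X), ?_, ?_, fun x h1 h2 => ?_⟩
    · refine natDegree_C_mul_le _ _ |>.trans ?_
      refine natDegree_comp_le.trans ?_
      have h1 : (Chebyshev.T ℝ (k : ℤ)).natDegree ≤ k := by simp
      have h2 : (C c - C (2 / (b - a)) * X : ℝ[X]).natDegree ≤ 1 := by compute_degree
      exact (Nat.mul_le_mul h1 h2).trans (by simp)
    · simp [hTpos.ne']
    · have hx : |c - 2 / (b - a) * x| ≤ 1 := by
        have h3 : c - 2 / (b - a) * x = (b + a - 2 * x) / (b - a) := by rw [hc]; ring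
        rw [h3, abs_div, abs_of_pos hba, div_le_one hba, abs_le]
        constructor <;> linarith
      have h3 := Chebyshev.abs_eval_T_real_le_one k hx
      have h4 : 1 - 2 / (1 + s) = t⁻¹ := by
        rw [ht]
        have : 1 + s ≠ 0 := by positivity
        have : s + 1 ≠ 0 := by positivity
        field_simp
        ring
      rw [h4]
      simp only [eval_mul, eval_C, eval_comp, eval_sub, eval_X, abs_mul, abs_inv, abs_of_pos hTpos]
      calc _ ≤ (t ^ k / 2)⁻¹ * 1 := by gcongr
        _ = _ := by rw [inv_pow]; field_simp

/-! ### Polynomials in a symmetric operator -/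

section Spectral

variable {E : Type*} [NormedAddCommGroup E] [InnerProductSpace ℝ E]

theorem aeval_apply_of_apply_eq_smul {T : Module.End ℝ E} {x : E} {c : ℝ} (h : T x = c • x)
    (p : Polynomial ℝ) : Polynomial.aeval T p x = p.eval c • x := by
  induction p using Polynomial.induction_on with
  | C a => simp
  | add p q hp hq => simp [hp, hq, add_smul]
  | monomial n a ih =>
    rw [pow_succ, ← mul_assoc, mul_comm, map_mul, Polynomial.aeval_X, Module.End.mul_apply, ih]
    simp [h, smul_smul]
    ring_nf

/-- A polynomial in a symmetric operator is bounded on `v` by its values at the eigenvalues whose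
eigenvectors are not orthogonal to `v`. -/
theorem LinearMap.IsSymmetric.norm_aeval_apply_le [FiniteDimensional ℝ E] {T : Module.End ℝ E} (hT : T.IsSymmetric)
    (p : Polynomial ℝ) {v : E} {ε : ℝ} (hε : 0 ≤ ε)
    (h : ∀ (c : ℝ) (x : E), T x = c • x → inner ℝ x v ≠ 0 → |p.eval c| ≤ ε) :
    ‖Polynomial.aeval T p v‖ ≤ ε * ‖v‖ := by
  set b := hT.eigenvectorBasis rfl
  set l := hT.eigenvalues rfl
  have hb : ∀ i, T (b i) = l i • b i := fun i =>
    hT.apply_eigenvectorBasis rfl i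
  have hinner : ∀ i, inner ℝ (b i) (Polynomial.aeval T p v) = p.eval (l i) * inner ℝ (b i) v := by
    intro i
    conv_lhs => rw [← b.sum_repr' v]
    simp only [map_sum, map_smul, aeval_apply_of_apply_eq_smul (hb _), inner_sum, inner_smul_right,
      b.inner_eq_ite]
    simp [mul_comm]
  refine le_of_sq_le_sq ?_ (by positivity)
  rw [mul_pow, ← b.sum_sq_norm_inner_right, ← b.sum_sq_norm_inner_right v, Finset.mul_sum]
  refine Finset.sum_le_sum fun i _ => ?_
  rw [hinner, norm_mul, mul_pow]
  by_cases h0 : inner ℝ (b i) v = 0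
  · simp [h0]
  · gcongr
    exact h _ _ (hb i) h0

end Spectral

/-! ### MINRES as a polynomial minimization -/

section Minres

variable {ι : Type} [Fintype ι] [DecidableEq ι]

/-- Since `q = X * q.divX + 1`, the vector `q(B) r` is the residual of the Krylov competitor
`q.divX(B) r`. -/
theorem JDSVD.IsMinresIterate.norm_linResidual_le {B : Matrix ι ι ℝ} {r w : EuclideanSpace ℝ ι}
    {j : ℕ} (hw : IsMinresIterate B r j w) {q : Polynomial ℝ} (hq : q.natDegree ≤ j)
    (hq0 : q.eval 0 = 1) :
    ‖linResidual B r w‖ ≤ ‖Polynomial.aeval (Matrix.toEuclideanLin B) q r‖ := by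
  set T : Module.End ℝ (EuclideanSpace ℝ ι) := Matrix.toEuclideanLin B with hT
  have hpow : ∀ i : ℕ, Matrix.toEuclideanLin (B ^ i) = T ^ i := by
    intro i
    induction i with
    | zero => ext x; simp
    | succ i ih =>
      rw [pow_succ, pow_succ, ← ih]
      ext x
      simp [hT, Matrix.toLpLin_apply]
  have hmem : Polynomial.aeval T q.divX r ∈ krylov B r j := by
    rw [Polynomial.aeval_eq_sum_range, LinearMap.sum_apply]
    refine Submodule.sum_mem _ fun i hi => ?_
    rw [LinearMap.smul_apply]
    by_cases h0 : q.divX.coeff i = 0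
    · simp [h0]
    refine Submodule.smul_mem _ _ (Submodule.subset_span ?_)
    have hij : i < j := by
      rw [Polynomial.coeff_divX] at h0
      have := Polynomial.le_natDegree_of_ne_zero h0
      omega
    exact ⟨⟨i, hij⟩, by simp [hpow]⟩
  refine (hw.2 _ hmem).trans (le_of_eq ?_)
  congr 1
  conv_rhs => rw [← Polynomial.divX_mul_X_add q]
  rw [linResidual, Polynomial.coeff_zero_eq_eval_zero, hq0, mul_comm]
  simp [hT]

/-- MINRES for a system that lives on the range of an orthogonal projector `Q`. -/
theorem JDSVD.IsMinresIterate.norm_linResidual_div_le {B Q : Matrix ι ι ℝ}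
    {r w : EuclideanSpace ℝ ι} {j : ℕ} (hw : IsMinresIterate B r j w) (hr : r ≠ 0)
    (hB : Bᵀ = B) (hQ : Qᵀ = Q) (hQQ : Q * Q = Q) (hBQ : B * Q = B) (hQB : Q * B = B)
    (hQr : Matrix.toEuclideanLin Q r = r) {q : Polynomial ℝ} (hq : q.natDegree ≤ j)
    (hq0 : q.eval 0 = 1) {ε : ℝ} (hε : 0 ≤ ε)
    (h : ∀ (c : ℝ) (x : EuclideanSpace ℝ ι), x ≠ 0 → Matrix.toEuclideanLin Q x = x →
      Matrix.toEuclideanLin B x = c • x → |q.eval c| ≤ ε) :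
    ‖linResidual B r w‖ / ‖r‖ ≤ ε := by
  rw [div_le_iff₀ (norm_pos_iff.2 hr)]
  refine (hw.norm_linResidual_le hq hq0).trans ?_
  have hsymm : ∀ C : Matrix ι ι ℝ, Cᵀ = C → (Matrix.toEuclideanLin C).IsSymmetric := fun C hC =>
    Matrix.isSymmetric_toEuclideanLin_iff.2 (by simpa [Matrix.IsHermitian] using hC)
  have hmul : ∀ (C D : Matrix ι ι ℝ) x, Matrix.toEuclideanLin (C * D) x =
      Matrix.toEuclideanLin C (Matrix.toEuclideanLin D x) := fun C D x => by
    simp [Matrix.toLpLin_apply, Matrix.mulVec_mulVec]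
  refine (hsymm B hB).norm_aeval_apply_le q hε fun c x hx hxr => ?_
  -- `x` itself may have a part in the kernel of `Q`. Replacing it by `Q x` keeps the eigenvalue,
  -- and `Q x ≠ 0` because `⟪Q x, r⟫ = ⟪x, r⟫ ≠ 0`. This discards the zero eigenvalue that comes
  -- only from that kernel.
  refine h c (Matrix.toEuclideanLin Q x) ?_ ?_ ?_
  · intro h0
    apply hxr
    rw [← hQr, ← hsymm Q hQ x r, h0, inner_zero_left]
  · rw [← hmul, hQQ]
  · rw [← hmul, hBQ, ← map_smul, ← hx, ← hmul, hQB]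

end Minres

/-! ### Perturbation of compressions in terms of subspace angles -/

section SubspaceGap

variable {X Y : Type*} [NormedAddCommGroup X] [InnerProductSpace ℝ X] [FiniteDimensional ℝ X]
  [NormedAddCommGroup Y] [InnerProductSpace ℝ Y] [FiniteDimensional ℝ Y]

theorem inner_starProjection_self (F : Submodule ℝ X) (x : X) :
    inner ℝ (F.starProjection x) x = ‖F.starProjection x‖ ^ 2 := by
  rw [← real_inner_self_eq_norm_sq, Submodule.inner_starProjection_left_eq_right,
    Submodule.inner_starProjection_left_eq_right,
    Submodule.starProjection_eq_self_iff.2 (Submodule.starProjection_apply_mem _ _)]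

/-- The sines of all canonical angles between `F` and `G` (in both directions) are at most `s`. -/
structure SubspaceGapLE (F G : Submodule ℝ X) (s : ℝ) : Prop where
  nonneg : 0 ≤ s
  le_one : s ≤ 1
  norm_left : ∀ x ∈ G, ‖Fᗮ.starProjection x‖ ≤ s * ‖x‖
  norm_right : ∀ x ∈ F, ‖Gᗮ.starProjection x‖ ≤ s * ‖x‖

/-- The norm of `P_G P_F` equals that of its adjoint `P_F P_G`. -/
theorem norm_starProjection_le_comm {F G : Submodule ℝ X} {s : ℝ} (hs : 0 ≤ s)
    (h : ∀ x ∈ F, ‖G.starProjection x‖ ≤ s * ‖x‖) {x : X} (hx : x ∈ G) :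
    ‖F.starProjection x‖ ≤ s * ‖x‖ := by
  set y := F.starProjection x with hy
  have h1 : ‖y‖ ^ 2 = inner ℝ (G.starProjection y) x := by
    rw [Submodule.inner_starProjection_left_eq_right, Submodule.starProjection_eq_self_iff.2 hx, hy,
      inner_starProjection_self]
  have h2 := (real_inner_le_norm (G.starProjection y) x).trans
    (mul_le_mul_of_nonneg_right (h y (Submodule.starProjection_apply_mem _ _)) (norm_nonneg x))
  rw [← h1] at h2
  rcases (norm_nonneg y).eq_or_lt with h0 | h0
  · rw [← h0]; positivity
  · nlinarith

namespace SubspaceGapLE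

variable {F G : Submodule ℝ X} {s : ℝ}

theorem symm (h : SubspaceGapLE F G s) : SubspaceGapLE G F s :=
  ⟨h.nonneg, h.le_one, h.norm_right, h.norm_left⟩

theorem norm_starProjection_le (h : SubspaceGapLE F G s) {x : X} (hx : x ∈ Fᗮ) :
    ‖G.starProjection x‖ ≤ s * ‖x‖ :=
  norm_starProjection_le_comm h.nonneg h.norm_left hx

theorem le_norm_sq_starProjection_orthogonal (h : SubspaceGapLE F G s) {x : X} (hx : x ∈ Fᗮ) :
    (1 - s ^ 2) * ‖x‖ ^ 2 ≤ ‖Gᗮ.starProjection x‖ ^ 2 := by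
  have h1 := G.norm_sq_eq_add_norm_sq_starProjection x
  have h2 := pow_le_pow_left₀ (norm_nonneg _) (h.norm_starProjection_le hx) 2
  have h3 := Submodule.norm_sq_eq_add_norm_sq_starProjection x G
  rw [mul_pow] at h2
  linarith

end SubspaceGapLE

variable {F G : Submodule ℝ X} {H K : Submodule ℝ Y} {s t : ℝ} {a : Y →ₗ[ℝ] X} {α β : ℝ}

/-- Two small factors multiply: `t` from projecting `y ∈ Hᗮ` to `K`, and `s` from projecting a
vector of `G` to `Fᗮ`. This makes the perturbation quadratic in the angles. -/
theorem norm_compression_apply_proj_le (hF : SubspaceGapLE F G s) (hH : SubspaceGapLE H K t)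
    (hα : 0 ≤ α) (ha : ∀ y, ‖a y‖ ≤ α * ‖y‖) (hK : ∀ y ∈ K, a y ∈ G) {y : Y} (hy : y ∈ Hᗮ) :
    ‖Fᗮ.starProjection (a (K.starProjection y))‖ ≤ α * (s * t) * ‖y‖ := by
  have h1 := hF.norm_left _ (hK _ (K.starProjection_apply_mem y))
  have h2 := ha (K.starProjection y)
  have h3 := hH.norm_starProjection_le hy
  have := hF.nonneg
  calc _ ≤ _ := h1
    _ ≤ s * (α * (t * ‖y‖)) := by gcongr; exact h2.trans (by gcongr)
    _ = _ := by ring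

theorem norm_compression_le (hF : SubspaceGapLE F G s) (hH : SubspaceGapLE H K t)
    (hα : 0 ≤ α) (ha : ∀ y, ‖a y‖ ≤ α * ‖y‖) (hK : ∀ y ∈ K, a y ∈ G)
    (hβ : 0 ≤ β) (hle : ∀ z ∈ Kᗮ, ‖a z‖ ≤ β * ‖z‖) {y : Y} (hy : y ∈ Hᗮ) :
    ‖Fᗮ.starProjection (a y)‖ ≤ (β + α * (s + t) ^ 2) * ‖y‖ := by
  have h1 := norm_compression_apply_proj_le hF hH hα ha hK hy
  have h2 : ‖Fᗮ.starProjection (a (Kᗮ.starProjection y))‖ ≤ β * ‖y‖ :=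
    (Submodule.norm_starProjection_apply_le _ _).trans <|
      (hle _ (Submodule.starProjection_apply_mem _ _)).trans <| by
        gcongr; exact Submodule.norm_starProjection_apply_le _ _
  have h3 : Fᗮ.starProjection (a y) = Fᗮ.starProjection (a (K.starProjection y)) +
      Fᗮ.starProjection (a (Kᗮ.starProjection y)) := by
    rw [← map_add, ← map_add, K.starProjection_add_starProjection_orthogonal]
  rw [h3]
  refine (norm_add_le _ _).trans ((add_le_add h1 h2).trans ?_)
  rw [← add_mul, add_comm]
  have := hF.nonneg
  have := hH.nonneg
  gcongr
  nlinarith [mul_nonneg hF.nonneg hH.nonneg]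

/-- The `Kᗮ` part of `y` stays in `Gᗮ` under `a`, and the two projections shrink it by factors no
worse than the cosines `√(1 - t²)` and `√(1 - s²)`. The resulting loss `β (s² + t²)` and the term `α
s t` from the `K` part fit into `α (s + t)²` because `β ≤ α`. -/
theorem le_norm_compression (hF : SubspaceGapLE F G s) (hH : SubspaceGapLE H K t)
    (hα : 0 ≤ α) (ha : ∀ y, ‖a y‖ ≤ α * ‖y‖) (hK : ∀ y ∈ K, a y ∈ G) (hK' : ∀ y ∈ Kᗮ, a y ∈ Gᗮ)
    (hβ : 0 ≤ β) (hβα : β ≤ α) (hle : ∀ z ∈ Kᗮ, β * ‖z‖ ≤ ‖a z‖) {y : Y} (hy : y ∈ Hᗮ) :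
    (β - α * (s + t) ^ 2) * ‖y‖ ≤ ‖Fᗮ.starProjection (a y)‖ := by
  have h1 := norm_compression_apply_proj_le hF hH hα ha hK hy
  have hs2 : 0 ≤ 1 - s ^ 2 := by nlinarith [hF.nonneg, hF.le_one]
  have ht2 : 0 ≤ 1 - t ^ 2 := by nlinarith [hH.nonneg, hH.le_one]
  set z := Kᗮ.starProjection y with hz
  have hzK : z ∈ Kᗮ := Submodule.starProjection_apply_mem _ _
  have h2 : β * (1 - s ^ 2 - t ^ 2) * ‖y‖ ≤ ‖Fᗮ.starProjection (a z)‖ := by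
    have e1 := hF.symm.le_norm_sq_starProjection_orthogonal (hK' z hzK)
    have e2 := pow_le_pow_left₀ (by positivity) (hle z hzK) 2
    have e3 := hH.le_norm_sq_starProjection_orthogonal hy
    refine (mul_le_mul_of_nonneg_right (mul_le_mul_of_nonneg_left
      (?_ : 1 - s ^ 2 - t ^ 2 ≤ (1 - s ^ 2) * (1 - t ^ 2)) hβ) (norm_nonneg y)).trans ?_
    · nlinarith [mul_nonneg (sq_nonneg s) (sq_nonneg t)]
    -- The product of cosines is replaced by the product of their squares, which is smaller as both
    -- lie in `[0, 1]`.
    refine le_of_sq_le_sq ?_ (norm_nonneg _)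
    calc (β * ((1 - s ^ 2) * (1 - t ^ 2)) * ‖y‖) ^ 2
        = (1 - s ^ 2) ^ 2 * (1 - t ^ 2) ^ 2 * (β ^ 2 * ‖y‖ ^ 2) := by ring
      _ ≤ (1 - s ^ 2) * (1 - t ^ 2) * (β ^ 2 * ‖y‖ ^ 2) := by
          gcongr
          · nlinarith [sq_nonneg s]
          · nlinarith [sq_nonneg t]
      _ = (1 - s ^ 2) * (β ^ 2 * ((1 - t ^ 2) * ‖y‖ ^ 2)) := by ring
      _ ≤ (1 - s ^ 2) * (β ^ 2 * ‖z‖ ^ 2) := by gcongr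
      _ ≤ (1 - s ^ 2) * ‖a z‖ ^ 2 := by rw [← mul_pow]; gcongr
      _ ≤ _ := e1
  have h3 : Fᗮ.starProjection (a y) = Fᗮ.starProjection (a (K.starProjection y)) +
      Fᗮ.starProjection (a z) := by
    rw [← map_add, ← map_add, K.starProjection_add_starProjection_orthogonal]
  have h4 : ‖Fᗮ.starProjection (a z)‖ ≤ ‖Fᗮ.starProjection (a y)‖ +
      ‖Fᗮ.starProjection (a (K.starProjection y))‖ := by
    have := norm_sub_le (Fᗮ.starProjection (a y)) (Fᗮ.starProjection (a (K.starProjection y)))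
    rwa [h3, add_sub_cancel_left, ← h3] at this
  have h5 : β - α * (s + t) ^ 2 ≤ β * (1 - s ^ 2 - t ^ 2) - α * (s * t) := by
    nlinarith [mul_nonneg hα (mul_nonneg hF.nonneg hH.nonneg),
      mul_nonneg (sub_nonneg.2 hβα) (sq_nonneg s), mul_nonneg (sub_nonneg.2 hβα) (sq_nonneg t)]
  have h6 := mul_le_mul_of_nonneg_right h5 (norm_nonneg y)
  linarith

/-- A lower bound for the eigenvalues of the compression of `[-τ, a; b, -τ]` to `Fᗮ × Hᗮ`, given
one for `[-τ, a; b, -τ]` on `Gᗮ × Kᗮ`. -/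
theorem le_abs_eigenvalue_of_compression {b : X →ₗ[ℝ] Y} {τ d c : ℝ}
    (hF : SubspaceGapLE F G s) (hH : SubspaceGapLE H K t)
    (hα : 0 ≤ α) (ha : ∀ y, ‖a y‖ ≤ α * ‖y‖) (hb : ∀ x, ‖b x‖ ≤ α * ‖x‖)
    (hK : ∀ y ∈ K, a y ∈ G) (hK' : ∀ y ∈ Kᗮ, a y ∈ Gᗮ)
    (hG : ∀ x ∈ G, b x ∈ K) (hG' : ∀ x ∈ Gᗮ, b x ∈ Kᗮ)
    (hτ : 0 ≤ τ) (hdα : d + τ ≤ α)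
    (hle : ∀ x ∈ Gᗮ, ∀ y ∈ Kᗮ, d ^ 2 * (‖x‖ ^ 2 + ‖y‖ ^ 2) ≤
      ‖a y - τ • x‖ ^ 2 + ‖b x - τ • y‖ ^ 2)
    {x : X} {y : Y} (hx : x ∈ Fᗮ) (hy : y ∈ Hᗮ) (hxy : x ≠ 0 ∨ y ≠ 0)
    (h1 : Fᗮ.starProjection (a y) = (c + τ) • x) (h2 : Hᗮ.starProjection (b x) = (c + τ) • y) :
    d - α * (s + t) ^ 2 ≤ |c| := by
  -- The two blocks lose different factors, `1 - s²` and `1 - t²`; the common factor `1 - u²` serves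
  -- the pair.
  set u := max s t with hu
  have hs0 := hF.nonneg
  have ht0 := hH.nonneg
  have hu0 : 0 ≤ u := hs0.trans (le_max_left _ _)
  have hu1 : u ≤ 1 := max_le hF.le_one hH.le_one
  have hu2 : 0 ≤ 1 - u ^ 2 := by nlinarith
  have hus : s ^ 2 ≤ u ^ 2 := pow_le_pow_left₀ hs0 (le_max_left _ _) 2
  have hut : t ^ 2 ≤ u ^ 2 := pow_le_pow_left₀ ht0 (le_max_right _ _) 2
  have hust : u ^ 2 + s * t ≤ (s + t) ^ 2 := by
    rcases max_choice s t with h | h <;> rw [hu, h] <;> nlinarith [mul_nonneg hs0 ht0, sq_nonneg s, sq_nonneg t]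
  set x₁ := G.starProjection x with hx₁
  set y₁ := K.starProjection y with hy₁
  set x₂ := Gᗮ.starProjection x with hx₂
  set y₂ := Kᗮ.starProjection y with hy₂
  have hxs : x₁ + x₂ = x := G.starProjection_add_starProjection_orthogonal x
  have hys : y₁ + y₂ = y := K.starProjection_add_starProjection_orthogonal y
  have hx₂G : x₂ ∈ Gᗮ := Submodule.starProjection_apply_mem _ _
  have hy₂K : y₂ ∈ Kᗮ := Submodule.starProjection_apply_mem _ _
  have hx₁n : ‖Fᗮ.starProjection x₁‖ ≤ u ^ 2 * ‖x‖ := by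
    refine (hF.norm_left _ (G.starProjection_apply_mem x)).trans ?_
    have := hF.norm_starProjection_le hx
    calc s * ‖x₁‖ ≤ s * (s * ‖x‖) := by gcongr
      _ = s ^ 2 * ‖x‖ := by ring
      _ ≤ _ := by gcongr
  have hy₁n : ‖Hᗮ.starProjection y₁‖ ≤ u ^ 2 * ‖y‖ := by
    refine (hH.norm_left _ (K.starProjection_apply_mem y)).trans ?_
    have := hH.norm_starProjection_le hy
    calc t * ‖y₁‖ ≤ t * (t * ‖y‖) := by gcongr
      _ = t ^ 2 * ‖y‖ := by ring
      _ ≤ _ := by gcongr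
  have hay₁ := norm_compression_apply_proj_le hF hH hα ha hK hy
  have hbx₁ := norm_compression_apply_proj_le hH hF hα hb hG hx
  set n : ℝ := √(‖x‖ ^ 2 + ‖y‖ ^ 2) with hn
  have hn2 : n ^ 2 = ‖x‖ ^ 2 + ‖y‖ ^ 2 := Real.sq_sqrt (by positivity)
  have hnpos : 0 < n := by
    apply Real.sqrt_pos.2
    rcases hxy with h | h
    · have := norm_pos_iff.2 h; positivity
    · have := norm_pos_iff.2 h; positivity
  have hlp : ∀ (v : X) (w : Y) {k : ℝ}, 0 ≤ k → ‖v‖ ≤ k * ‖x‖ → ‖w‖ ≤ k * ‖y‖ →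
      ‖WithLp.toLp 2 (v, w)‖ ≤ k * n := by
    intro v w k hk hv hw
    refine le_of_sq_le_sq ?_ (by positivity)
    rw [WithLp.prod_norm_sq_eq_of_L2, mul_pow, hn2, mul_add, ← mul_pow, ← mul_pow]
    exact add_le_add (pow_le_pow_left₀ (norm_nonneg _) hv 2) (pow_le_pow_left₀ (norm_nonneg _) hw 2)
  have e1 : ‖WithLp.toLp 2 (c • x, c • y)‖ ≤ |c| * n :=
    hlp _ _ (abs_nonneg c) (by rw [norm_smul, Real.norm_eq_abs]) (by rw [norm_smul, Real.norm_eq_abs])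
  have e2 : ‖WithLp.toLp 2 (τ • Fᗮ.starProjection x₁, τ • Hᗮ.starProjection y₁)‖ ≤ τ * u ^ 2 * n :=
    hlp _ _ (by positivity)
      (by rw [norm_smul, Real.norm_of_nonneg hτ, mul_assoc]; gcongr)
      (by rw [norm_smul, Real.norm_of_nonneg hτ, mul_assoc]; gcongr)
  -- The off-diagonal operators exchange the blocks: the first component is controlled by `‖y‖`, the
  -- second by `‖x‖`.
  have e3 : ‖WithLp.toLp 2 (Fᗮ.starProjection (a y₁), Hᗮ.starProjection (b x₁))‖ ≤
      α * (s * t) * n := by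
    refine le_of_sq_le_sq ?_ (by positivity)
    rw [WithLp.prod_norm_sq_eq_of_L2, mul_pow, hn2, mul_add, ← mul_pow, ← mul_pow, add_comm]
    refine add_le_add (pow_le_pow_left₀ (norm_nonneg _) ?_ 2)
      (pow_le_pow_left₀ (norm_nonneg _) hay₁ 2)
    rw [mul_comm s t]; exact hbx₁
  have e4 : (1 - u ^ 2) * d * n ≤ ‖WithLp.toLp 2 (Fᗮ.starProjection (a y₂ - τ • x₂),
      Hᗮ.starProjection (b x₂ - τ • y₂))‖ := by
    refine le_of_sq_le_sq ?_ (norm_nonneg _)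
    rw [WithLp.prod_norm_sq_eq_of_L2]
    have f1 := hF.symm.le_norm_sq_starProjection_orthogonal
      (Gᗮ.sub_mem (hK' _ hy₂K) (Gᗮ.smul_mem τ hx₂G))
    have f2 := hH.symm.le_norm_sq_starProjection_orthogonal
      (Kᗮ.sub_mem (hG' _ hx₂G) (Kᗮ.smul_mem τ hy₂K))
    have f3 := hF.le_norm_sq_starProjection_orthogonal hx
    have f4 := hH.le_norm_sq_starProjection_orthogonal hy
    calc ((1 - u ^ 2) * d * n) ^ 2
        = (1 - u ^ 2) * (d ^ 2 * ((1 - u ^ 2) * ‖x‖ ^ 2 + (1 - u ^ 2) * ‖y‖ ^ 2)) := by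
          rw [mul_pow, hn2]; ring
      _ ≤ (1 - u ^ 2) * (d ^ 2 * (‖x₂‖ ^ 2 + ‖y₂‖ ^ 2)) := by
          gcongr
          · exact le_trans (by gcongr) f3
          · exact le_trans (by gcongr) f4
      _ ≤ (1 - u ^ 2) * (‖a y₂ - τ • x₂‖ ^ 2 + ‖b x₂ - τ • y₂‖ ^ 2) := by
          gcongr; exact hle _ hx₂G _ hy₂K
      _ ≤ _ := by
          rw [mul_add]
          refine add_le_add (le_trans (by gcongr) f1) (le_trans (by gcongr) f2)
  -- The eigenvalue equation is solved for the contribution of `Gᗮ × Kᗮ`; the other terms on the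
  -- right are of second order.
  have hsum : WithLp.toLp 2 (Fᗮ.starProjection (a y₂ - τ • x₂), Hᗮ.starProjection (b x₂ - τ • y₂))
      = WithLp.toLp 2 (c • x, c • y) +
        WithLp.toLp 2 (τ • Fᗮ.starProjection x₁, τ • Hᗮ.starProjection y₁) -
        WithLp.toLp 2 (Fᗮ.starProjection (a y₁), Hᗮ.starProjection (b x₁)) := by
    have g1 : Fᗮ.starProjection x = x := Submodule.starProjection_eq_self_iff.2 hx
    have g2 : Hᗮ.starProjection y = y := Submodule.starProjection_eq_self_iff.2 hy
    have k1 : Fᗮ.starProjection (a y₁) + Fᗮ.starProjection (a y₂) = (c + τ) • x := by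
      rw [← map_add, ← map_add, hys, h1]
    have k2 : Hᗮ.starProjection (b x₁) + Hᗮ.starProjection (b x₂) = (c + τ) • y := by
      rw [← map_add, ← map_add, hxs, h2]
    have l1 : Fᗮ.starProjection x₁ + Fᗮ.starProjection x₂ = x := by rw [← map_add, hxs, g1]
    have l2 : Hᗮ.starProjection y₁ + Hᗮ.starProjection y₂ = y := by rw [← map_add, hys, g2]
    rw [← WithLp.toLp_add, ← WithLp.toLp_sub]
    congr 1
    simp only [Prod.mk_add_mk, Prod.mk_sub_mk, map_sub, map_smul]
    rw [← eq_sub_iff_add_eq'] at k1 k2 l1 l2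
    rw [k1, k2, l1, l2]
    congr 1 <;> module
  have e5 : (1 - u ^ 2) * d * n ≤ |c| * n + τ * u ^ 2 * n + α * (s * t) * n := by
    rw [hsum] at e4
    exact e4.trans ((norm_sub_le _ _).trans (add_le_add ((norm_add_le _ _).trans
      (add_le_add e1 e2)) e3))
  rw [← add_mul, ← add_mul] at e5
  have e6 := le_of_mul_le_mul_right e5 hnpos
  -- `|c| ≥ d - (d + τ) u² - α s t ≥ d - α (u² + s t)`, by `d + τ ≤ α`.
  nlinarith [mul_le_mul_of_nonneg_right hdα (sq_nonneg u), mul_le_mul_of_nonneg_left hust hα]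

end SubspaceGap

/-! ### From canonical angles to projection bounds -/

section CanonicalAngles

/-- In an eigenbasis of `T* T`, `‖T x‖²` is the sum of the squared coordinates of `x` weighted by
the squared singular values. -/
theorem LinearMap.le_norm_apply_of_le_singularValues {E F : Type*} [NormedAddCommGroup E]
    [InnerProductSpace ℝ E] [FiniteDimensional ℝ E] [NormedAddCommGroup F] [InnerProductSpace ℝ F]
    [FiniteDimensional ℝ F] (T : E →ₗ[ℝ] F) {c : ℝ} (hc : 0 ≤ c)
    (h : ∀ i < Module.finrank ℝ E, c ≤ T.singularValues i) (x : E) : c * ‖x‖ ≤ ‖T x‖ := by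
  have hS := T.isSymmetric_adjoint_comp_self
  set b := hS.eigenvectorBasis rfl
  refine le_of_sq_le_sq ?_ (norm_nonneg _)
  have h1 : ‖T x‖ ^ 2 = ∑ i, hS.eigenvalues rfl i * inner ℝ (b i) x ^ 2 := by
    rw [← real_inner_self_eq_norm_sq, ← LinearMap.adjoint_inner_left,
      ← b.sum_inner_mul_inner]
    refine Finset.sum_congr rfl fun i _ => ?_
    have h2 := hS (b i) x
    rw [hS.apply_eigenvectorBasis rfl i] at h2
    rw [LinearMap.comp_apply] at h2
    rw [real_inner_comm, ← h2]
    simp only [b, RCLike.ofReal_real_eq_id, inner_smul_left]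
    simp
    ring
  rw [h1, mul_pow, ← b.sum_sq_norm_inner_right, Finset.mul_sum]
  refine Finset.sum_le_sum fun i _ => ?_
  rw [Real.norm_eq_abs, sq_abs, ← T.sq_singularValues_fin rfl i]
  gcongr
  exact h i i.2

theorem sinCanonicalAngles_norm_le_one {n m : ℕ} (F G : Submodule ℝ (EuclideanSpace ℝ (Fin n))) :
    ‖sinCanonicalAngles m F G‖ ≤ 1 := by
  rw [sinCanonicalAngles, Matrix.l2_opNorm_diagonal]
  exact (pi_norm_le_iff_of_nonneg zero_le_one).2 fun i => by
    rw [Real.norm_eq_abs]; exact Real.abs_sin_le_one _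

/-- The last singular value `c` of `P_F` on `G` is the cosine of the largest angle, so `‖P_F x‖ ≥ c
‖x‖` on `G` and Pythagoras gives one direction. The other uses equal dimensions: for `c > 0` the map
is bijective, so each `x ∈ F` is `P_F y` with `y ∈ G` and `c ‖y‖ ≤ ‖x‖`, and `‖x‖² = ⟪y, P_G x⟫`. -/
theorem subspaceGapLE_norm_sinCanonicalAngles {n m : ℕ} (hm : 1 ≤ m)
    {F G : Submodule ℝ (EuclideanSpace ℝ (Fin n))} (hF : Module.finrank ℝ F = m)
    (hG : Module.finrank ℝ G = m) : SubspaceGapLE F G ‖sinCanonicalAngles m F G‖ := by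
  set s := ‖sinCanonicalAngles m F G‖ with hs
  set T := (F.orthogonalProjectionOnto ∘L G.subtypeL).toLinearMap with hT
  set c := T.singularValues (m - 1) with hc
  have hc0 : 0 ≤ c := T.singularValues_nonneg _
  have hcs : 1 - c ^ 2 ≤ s ^ 2 := by
    have h1 : √(1 - c ^ 2) ≤ s := by
      rw [← Real.sin_arccos, hs, sinCanonicalAngles, Matrix.l2_opNorm_diagonal]
      exact (le_abs_self _).trans
        (norm_le_pi_norm (fun i : Fin m => Real.sin (canonicalAngle F G i)) ⟨m - 1, by omega⟩)
    exact (Real.sqrt_le_left (norm_nonneg _)).1 h1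
  have hTle : ∀ x : G, c * ‖x‖ ≤ ‖T x‖ := T.le_norm_apply_of_le_singularValues hc0
    fun i hi => T.singularValues_antitone (by omega)
  have key : ∀ (L : Submodule ℝ (EuclideanSpace ℝ (Fin n))) (x : EuclideanSpace ℝ (Fin n)),
      c * ‖x‖ ≤ ‖L.starProjection x‖ → ‖Lᗮ.starProjection x‖ ≤ s * ‖x‖ := by
    intro L x h
    refine le_of_sq_le_sq ?_ (by positivity)
    have h1 := L.norm_sq_eq_add_norm_sq_starProjection x
    have h2 := pow_le_pow_left₀ (by positivity) h 2
    have h3 := Submodule.norm_sq_eq_add_norm_sq_starProjection x L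
    rw [mul_pow] at h2 ⊢
    nlinarith [mul_le_mul_of_nonneg_right hcs (sq_nonneg ‖x‖)]
  refine ⟨norm_nonneg _, sinCanonicalAngles_norm_le_one F G, fun x hx => key F x (hTle ⟨x, hx⟩),
    fun x hx => key G x ?_⟩
  rcases hc0.eq_or_lt with h0 | h0
  · rw [← h0, zero_mul]; exact norm_nonneg _
  have hinj : Function.Injective T := by
    rw [injective_iff_map_eq_zero]
    intro y hy
    have := hTle y
    rw [hy, norm_zero] at this
    exact norm_eq_zero.1 (le_antisymm (nonpos_of_mul_nonpos_right this h0) (norm_nonneg _))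
  obtain ⟨y, hy⟩ := (LinearMap.injective_iff_surjective_of_finrank_eq_finrank
    (hG.trans hF.symm)).1 hinj ⟨x, hx⟩
  have hyx : F.starProjection (y : EuclideanSpace ℝ (Fin n)) = x := congrArg Subtype.val hy
  have h1 : c * ‖y‖ ≤ ‖x‖ := by
    have := hTle y
    rwa [hy] at this
  have h2 : ‖x‖ ^ 2 = inner ℝ (y : EuclideanSpace ℝ (Fin n)) (G.starProjection x) := by
    rw [← Submodule.inner_starProjection_left_eq_right, Submodule.starProjection_eq_self_iff.2 y.2,
      ← hyx, ← inner_starProjection_self, real_inner_comm]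
  have h3 := real_inner_le_norm (y : EuclideanSpace ℝ (Fin n)) (G.starProjection x)
  rw [← h2] at h3
  rcases (norm_nonneg x).eq_or_lt with hx0 | hx0
  · rw [← hx0, mul_zero]; exact norm_nonneg _
  have h4 : c * ‖x‖ ^ 2 ≤ ‖x‖ * ‖G.starProjection x‖ := calc
    c * ‖x‖ ^ 2 ≤ c * (‖(y : EuclideanSpace ℝ (Fin n))‖ * ‖G.starProjection x‖) := by gcongr
    _ = (c * ‖y‖) * ‖G.starProjection x‖ := by rw [mul_assoc]; rfl
    _ ≤ _ := by gcongr
  nlinarith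

end CanonicalAngles

/-! ### Column spaces, their projectors and coordinates -/

section Columns

variable {n m : ℕ}

theorem toEuclideanLin_mul_apply {ι κ μ : Type*} [Fintype ι] [DecidableEq ι] [Fintype κ]
    [DecidableEq κ] (C : Matrix μ ι ℝ) (D : Matrix ι κ ℝ)
    (x : EuclideanSpace ℝ κ) :
    Matrix.toEuclideanLin (C * D) x = Matrix.toEuclideanLin C (Matrix.toEuclideanLin D x) := by
  simp [Matrix.toLpLin_apply, Matrix.mulVec_mulVec]

theorem inner_toEuclideanLin_right {ι κ : Type*} [Fintype ι] [DecidableEq ι] [Fintype κ]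
    [DecidableEq κ] (C : Matrix ι κ ℝ) (x : EuclideanSpace ℝ ι) (y : EuclideanSpace ℝ κ) :
    inner ℝ x (Matrix.toEuclideanLin C y) = inner ℝ (Matrix.toEuclideanLin Cᵀ x) y := by
  rw [← Matrix.conjTranspose_eq_transpose_of_trivial, Matrix.toEuclideanLin_conjTranspose_eq_adjoint,
    LinearMap.adjoint_inner_left]

theorem norm_toEuclideanLin_apply_of_transpose_mul_self {C : Matrix (Fin n) (Fin m) ℝ}
    (hC : Cᵀ * C = 1) (x : EuclideanSpace ℝ (Fin m)) : ‖Matrix.toEuclideanLin C x‖ = ‖x‖ := by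
  rw [← sq_eq_sq₀ (norm_nonneg _) (norm_nonneg _), ← real_inner_self_eq_norm_sq,
    inner_toEuclideanLin_right, ← toEuclideanLin_mul_apply, hC, ← real_inner_self_eq_norm_sq]
  simp

theorem norm_toEuclideanLin_apply_le (C : Matrix (Fin n) (Fin m) ℝ)
    (x : EuclideanSpace ℝ (Fin m)) : ‖Matrix.toEuclideanLin C x‖ ≤ ‖C‖ * ‖x‖ :=
  C.l2_opNorm_mulVec x

theorem norm_transpose_eq (C : Matrix (Fin n) (Fin m) ℝ) : ‖Cᵀ‖ = ‖C‖ := by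
  rw [← Matrix.conjTranspose_eq_transpose_of_trivial, Matrix.l2_opNorm_conjTranspose]

theorem mem_columnSpace_orthogonal_iff {C : Matrix (Fin n) (Fin m) ℝ}
    {x : EuclideanSpace ℝ (Fin n)} :
    x ∈ (columnSpace C)ᗮ ↔ Matrix.toEuclideanLin Cᵀ x = 0 := by
  rw [Submodule.mem_orthogonal']
  constructor
  · intro h
    rw [← inner_self_eq_zero (𝕜 := ℝ), ← inner_toEuclideanLin_right]
    exact h _ ⟨_, rfl⟩
  · rintro h _ ⟨y, rfl⟩
    rw [inner_toEuclideanLin_right, h, inner_zero_left]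

theorem finrank_columnSpace {C : Matrix (Fin n) (Fin m) ℝ} (hC : Cᵀ * C = 1) :
    Module.finrank ℝ (columnSpace C) = m := by
  rw [columnSpace, LinearMap.finrank_range_of_inj]
  · simp
  · rw [injective_iff_map_eq_zero]
    intro x hx
    rw [← norm_eq_zero, ← norm_toEuclideanLin_apply_of_transpose_mul_self hC x, hx, norm_zero]

theorem starProjection_columnSpace_orthogonal {C : Matrix (Fin n) (Fin m) ℝ} (hC : Cᵀ * C = 1)
    (x : EuclideanSpace ℝ (Fin n)) :
    (columnSpace C)ᗮ.starProjection x = Matrix.toEuclideanLin (1 - C * Cᵀ) x := by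
  apply Submodule.eq_starProjection_of_mem_orthogonal
  · rw [mem_columnSpace_orthogonal_iff, ← toEuclideanLin_mul_apply, Matrix.mul_sub, ← Matrix.mul_assoc, hC]
    simp
  · rw [Submodule.orthogonal_orthogonal]
    refine ⟨Matrix.toEuclideanLin Cᵀ x, ?_⟩
    rw [← toEuclideanLin_mul_apply, map_sub, LinearMap.sub_apply]
    simp

theorem transpose_mul_firstColumns (h : m ≤ n) {U : Matrix (Fin n) (Fin n) ℝ} (hU : Uᵀ * U = 1) :
    Uᵀ * firstColumns h U = (1 : Matrix (Fin n) (Fin n) ℝ).submatrix id (Fin.castLE h) := by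
  rw [← hU]
  rfl

theorem firstColumns_transpose_mul_self (h : m ≤ n) {U : Matrix (Fin n) (Fin n) ℝ}
    (hU : Uᵀ * U = 1) : (firstColumns h U)ᵀ * firstColumns h U = 1 := by
  ext i j
  have := congrFun₂ hU (Fin.castLE h i) (Fin.castLE h j)
  rw [Matrix.one_apply] at this ⊢
  simp only [(Fin.castLE_injective h).eq_iff] at this
  rw [← this]
  rfl

/-- In the coordinates `Uᵀ x`, exact singular subspaces become coordinate subspaces, so norm
estimates reduce to termwise bounds. -/
theorem mem_columnSpace_firstColumns_orthogonal_iff (h : m ≤ n) {U : Matrix (Fin n) (Fin n) ℝ}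
    {x : EuclideanSpace ℝ (Fin n)} :
    x ∈ (columnSpace (firstColumns h U))ᗮ ↔
      ∀ i : Fin n, (i : ℕ) < m → Matrix.toEuclideanLin Uᵀ x i = 0 := by
  have key : ∀ i : Fin m, Matrix.toEuclideanLin (firstColumns h U)ᵀ x i =
      Matrix.toEuclideanLin Uᵀ x (Fin.castLE h i) := fun i => rfl
  rw [mem_columnSpace_orthogonal_iff]
  constructor
  · intro h0 i hi
    rw [show i = Fin.castLE h ⟨i, hi⟩ from rfl, ← key, h0]
    rfl
  · intro h0
    ext i
    rw [key, h0 _ i.2]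
    rfl

theorem mem_columnSpace_firstColumns_iff (h : m ≤ n) {U : Matrix (Fin n) (Fin n) ℝ}
    (hU : Uᵀ * U = 1) {x : EuclideanSpace ℝ (Fin n)} :
    x ∈ columnSpace (firstColumns h U) ↔
      ∀ i : Fin n, m ≤ (i : ℕ) → Matrix.toEuclideanLin Uᵀ x i = 0 := by
  constructor
  · rintro ⟨y, rfl⟩ i hi
    rw [← toEuclideanLin_mul_apply, transpose_mul_firstColumns h hU]
    simp only [Matrix.toLpLin_apply, Matrix.mulVec, dotProduct]
    refine Finset.sum_eq_zero fun j _ => ?_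
    have hne : i ≠ Fin.castLE h j := fun e => by
      have := congrArg Fin.val e
      have := j.2
      simp at *
      omega
    exact mul_eq_zero_of_left (Matrix.one_apply_ne hne) _
  · intro h0
    rw [← Submodule.orthogonal_orthogonal (columnSpace (firstColumns h U)),
      Submodule.mem_orthogonal]
    intro z hz
    rw [mem_columnSpace_firstColumns_orthogonal_iff] at hz
    have hUU : U * Uᵀ = 1 := mul_eq_one_comm.1 hU
    have : x = Matrix.toEuclideanLin U (Matrix.toEuclideanLin Uᵀ x) := by
      rw [← toEuclideanLin_mul_apply, hUU]; simp
    rw [this, inner_toEuclideanLin_right, PiLp.inner_apply]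
    refine Finset.sum_eq_zero fun i _ => ?_
    by_cases hi : (i : ℕ) < m
    · rw [hz i hi, inner_zero_left]
    · rw [h0 i (not_lt.1 hi), inner_zero_right]

end Columns

/-! ### The operator in singular vector coordinates -/

/-- Separates the left coordinates paired with a right singular vector from the `M - N` unpaired
ones, on which `Aᵀ` vanishes. -/
theorem Fin.sum_univ_eq_sum_castLE_add {M N : ℕ} (h : N ≤ M) (f : Fin M → ℝ) :
    ∑ i, f i = ∑ j, f (Fin.castLE h j) + ∑ i : Fin M, if N ≤ (i : ℕ) then f i else 0 := by
  obtain ⟨k, rfl⟩ := Nat.exists_eq_add_of_le h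
  rw [Fin.sum_univ_add, Fin.sum_univ_add (fun i => if N ≤ (i : ℕ) then f i else 0)]
  have h1 : ∀ i : Fin N, ¬ N ≤ (i : ℕ) := fun i => not_le.2 i.2
  simp [h1]
  rfl

namespace JDSVD.IsSVD

variable {M N m : ℕ} {A : Matrix (Fin M) (Fin N) ℝ} {U : Matrix (Fin M) (Fin M) ℝ}
  {σ : Fin N → ℝ} {V : Matrix (Fin N) (Fin N) ℝ}

theorem left_transpose_mul_self (h : IsSVD A U σ V) : Uᵀ * U = 1 := by
  have := (Matrix.mem_orthogonalGroup_iff' (Fin M) ℝ).1 h.left_orthogonal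
  simpa [Matrix.star_eq_conjTranspose] using this

theorem right_transpose_mul_self (h : IsSVD A U σ V) : Vᵀ * V = 1 := by
  have := (Matrix.mem_orthogonalGroup_iff' (Fin N) ℝ).1 h.right_orthogonal
  simpa [Matrix.star_eq_conjTranspose] using this

theorem left_coord_castLE (h : IsSVD A U σ V) (hNM : N ≤ M) (y : EuclideanSpace ℝ (Fin N))
    (j : Fin N) :
    Matrix.toEuclideanLin Uᵀ (Matrix.toEuclideanLin A y) (Fin.castLE hNM j) =
      σ j * Matrix.toEuclideanLin Vᵀ y j := by
  have h1 : Uᵀ * A = rectDiagonal M σ * Vᵀ := by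
    rw [h.eq, ← Matrix.mul_assoc, ← Matrix.mul_assoc, h.left_transpose_mul_self, Matrix.one_mul]
  rw [← toEuclideanLin_mul_apply, h1, toEuclideanLin_mul_apply,
    Matrix.toLpLin_apply (M := rectDiagonal M σ)]
  simp [Matrix.mulVec, dotProduct, rectDiagonal, Fin.val_inj]

theorem left_coord_of_le (h : IsSVD A U σ V) (y : EuclideanSpace ℝ (Fin N))
    (i : Fin M) (hi : N ≤ (i : ℕ)) :
    Matrix.toEuclideanLin Uᵀ (Matrix.toEuclideanLin A y) i = 0 := by
  have h1 : Uᵀ * A = rectDiagonal M σ * Vᵀ := by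
    rw [h.eq, ← Matrix.mul_assoc, ← Matrix.mul_assoc, h.left_transpose_mul_self, Matrix.one_mul]
  rw [← toEuclideanLin_mul_apply, h1, toEuclideanLin_mul_apply,
    Matrix.toLpLin_apply (M := rectDiagonal M σ)]
  simp only [Matrix.mulVec, dotProduct]
  refine Finset.sum_eq_zero fun j _ => ?_
  have : (i : ℕ) ≠ j := by have := j.2; omega
  simp [rectDiagonal, this]

theorem right_coord (h : IsSVD A U σ V) (hNM : N ≤ M) (x : EuclideanSpace ℝ (Fin M))
    (j : Fin N) :
    Matrix.toEuclideanLin Vᵀ (Matrix.toEuclideanLin Aᵀ x) j =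
      σ j * Matrix.toEuclideanLin Uᵀ x (Fin.castLE hNM j) := by
  have h1 : Vᵀ * Aᵀ = (rectDiagonal M σ)ᵀ * Uᵀ := by
    rw [h.eq, Matrix.transpose_mul, Matrix.transpose_mul, Matrix.transpose_transpose, ← Matrix.mul_assoc,
      h.right_transpose_mul_self, Matrix.one_mul]
  rw [← toEuclideanLin_mul_apply, h1, toEuclideanLin_mul_apply,
    Matrix.toLpLin_apply (M := (rectDiagonal M σ)ᵀ)]
  have : ∀ i : Fin M, ((i : ℕ) = j) ↔ i = Fin.castLE hNM j := fun i => by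
    rw [Fin.ext_iff]; rfl
  simp [Matrix.mulVec, dotProduct, rectDiagonal, this]

theorem norm_left (h : IsSVD A U σ V) (x : EuclideanSpace ℝ (Fin M)) :
    ‖x‖ ^ 2 = ∑ i, Matrix.toEuclideanLin Uᵀ x i ^ 2 := by
  rw [← norm_toEuclideanLin_apply_of_transpose_mul_self (C := Uᵀ)
    (by simpa using mul_eq_one_comm.1 h.left_transpose_mul_self) x, EuclideanSpace.norm_sq_eq]
  simp

theorem norm_right (h : IsSVD A U σ V) (y : EuclideanSpace ℝ (Fin N)) :
    ‖y‖ ^ 2 = ∑ i, Matrix.toEuclideanLin Vᵀ y i ^ 2 := by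
  rw [← norm_toEuclideanLin_apply_of_transpose_mul_self (C := Vᵀ)
    (by simpa using mul_eq_one_comm.1 h.right_transpose_mul_self) y, EuclideanSpace.norm_sq_eq]
  simp

theorem norm_apply_sq (h : IsSVD A U σ V) (hNM : N ≤ M) (y : EuclideanSpace ℝ (Fin N)) :
    ‖Matrix.toEuclideanLin A y‖ ^ 2 = ∑ j, σ j ^ 2 * Matrix.toEuclideanLin Vᵀ y j ^ 2 := by
  rw [h.norm_left, Fin.sum_univ_eq_sum_castLE_add hNM]
  have h2 : ∀ i : Fin M, (if N ≤ (i : ℕ) then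
      Matrix.toEuclideanLin Uᵀ (Matrix.toEuclideanLin A y) i ^ 2 else 0) = 0 := fun i => by
    split_ifs with hi
    · rw [h.left_coord_of_le y i hi]; simp
    · rfl
  simp only [h2, h.left_coord_castLE hNM, mul_pow, Finset.sum_const_zero, add_zero]

theorem norm_transpose_apply_sq (h : IsSVD A U σ V) (hNM : N ≤ M)
    (x : EuclideanSpace ℝ (Fin M)) : ‖Matrix.toEuclideanLin Aᵀ x‖ ^ 2 =
      ∑ j, σ j ^ 2 * Matrix.toEuclideanLin Uᵀ x (Fin.castLE hNM j) ^ 2 := by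
  rw [h.norm_right]
  simp only [h.right_coord hNM, mul_pow]

theorem singularValue_le_norm (h : IsSVD A U σ V) (hNM : N ≤ M) (i : Fin N) : σ i ≤ ‖A‖ := by
  have h1 := norm_toEuclideanLin_apply_le A (Matrix.toEuclideanLin V (EuclideanSpace.single i 1))
  rw [norm_toEuclideanLin_apply_of_transpose_mul_self h.right_transpose_mul_self] at h1
  simp only [PiLp.norm_single, norm_one, mul_one] at h1
  refine le_trans (le_of_sq_le_sq ?_ (norm_nonneg _)) h1
  rw [h.norm_apply_sq hNM, ← toEuclideanLin_mul_apply, h.right_transpose_mul_self]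
  refine le_trans (le_of_eq ?_) (Finset.single_le_sum (f := fun j => σ j ^ 2 *
    (Matrix.toEuclideanLin (1 : Matrix (Fin N) (Fin N) ℝ) (EuclideanSpace.single i 1)) j ^ 2)
    (fun j _ => by positivity) (Finset.mem_univ i))
  simp

theorem apply_mem_columnSpace (h : IsSVD A U σ V) (hNM : N ≤ M) (hm : m ≤ N)
    (y : EuclideanSpace ℝ (Fin N)) (hy : y ∈ columnSpace (firstColumns hm V)) :
    Matrix.toEuclideanLin A y ∈ columnSpace (firstColumns (hm.trans hNM) U) := by
  rw [mem_columnSpace_firstColumns_iff _ h.right_transpose_mul_self] at hy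
  rw [mem_columnSpace_firstColumns_iff _ h.left_transpose_mul_self]
  intro i hi
  by_cases hiN : (i : ℕ) < N
  · rw [show i = Fin.castLE hNM ⟨i, hiN⟩ from rfl, h.left_coord_castLE, hy _ hi, mul_zero]
  · exact h.left_coord_of_le y i (not_lt.1 hiN)

theorem apply_mem_columnSpace_orthogonal (h : IsSVD A U σ V) (hNM : N ≤ M) (hm : m ≤ N)
    (y : EuclideanSpace ℝ (Fin N)) (hy : y ∈ (columnSpace (firstColumns hm V))ᗮ) :
    Matrix.toEuclideanLin A y ∈ (columnSpace (firstColumns (hm.trans hNM) U))ᗮ := by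
  rw [mem_columnSpace_firstColumns_orthogonal_iff] at hy ⊢
  intro i hi
  rw [show i = Fin.castLE hNM ⟨i, hi.trans_le hm⟩ from rfl, h.left_coord_castLE, hy _ hi, mul_zero]

theorem transpose_apply_mem_columnSpace (h : IsSVD A U σ V) (hNM : N ≤ M) (hm : m ≤ N)
    (x : EuclideanSpace ℝ (Fin M)) (hx : x ∈ columnSpace (firstColumns (hm.trans hNM) U)) :
    Matrix.toEuclideanLin Aᵀ x ∈ columnSpace (firstColumns hm V) := by
  rw [mem_columnSpace_firstColumns_iff _ h.left_transpose_mul_self] at hx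
  rw [mem_columnSpace_firstColumns_iff _ h.right_transpose_mul_self]
  intro i hi
  rw [h.right_coord hNM, hx _ hi, mul_zero]

theorem transpose_apply_mem_columnSpace_orthogonal (h : IsSVD A U σ V) (hNM : N ≤ M) (hm : m ≤ N)
    (x : EuclideanSpace ℝ (Fin M)) (hx : x ∈ (columnSpace (firstColumns (hm.trans hNM) U))ᗮ) :
    Matrix.toEuclideanLin Aᵀ x ∈ (columnSpace (firstColumns hm V))ᗮ := by
  rw [mem_columnSpace_firstColumns_orthogonal_iff] at hx ⊢
  intro i hi
  rw [h.right_coord hNM, hx _ hi, mul_zero]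

theorem norm_apply_le_of_mem_orthogonal (h : IsSVD A U σ V) (hNM : N ≤ M) (hm : m ≤ N) {β : ℝ}
    (hβ : 0 ≤ β) (hσ : ∀ i : Fin N, m ≤ (i : ℕ) → σ i ≤ β) (y : EuclideanSpace ℝ (Fin N))
    (hy : y ∈ (columnSpace (firstColumns hm V))ᗮ) :
    ‖Matrix.toEuclideanLin A y‖ ≤ β * ‖y‖ := by
  rw [mem_columnSpace_firstColumns_orthogonal_iff] at hy
  refine le_of_sq_le_sq ?_ (by positivity)
  rw [h.norm_apply_sq hNM, mul_pow, h.norm_right, Finset.mul_sum]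
  refine Finset.sum_le_sum fun i _ => ?_
  by_cases hi : (i : ℕ) < m
  · simp [hy i hi]
  · have := h.nonneg i
    have := hσ i (not_lt.1 hi)
    gcongr

theorem le_norm_apply_of_mem_orthogonal (h : IsSVD A U σ V) (hNM : N ≤ M) (hm : m ≤ N) {β : ℝ}
    (hβ : 0 ≤ β) (hσ : ∀ i : Fin N, m ≤ (i : ℕ) → β ≤ σ i) (y : EuclideanSpace ℝ (Fin N))
    (hy : y ∈ (columnSpace (firstColumns hm V))ᗮ) :
    β * ‖y‖ ≤ ‖Matrix.toEuclideanLin A y‖ := by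
  rw [mem_columnSpace_firstColumns_orthogonal_iff] at hy
  refine le_of_sq_le_sq ?_ (norm_nonneg _)
  rw [h.norm_apply_sq hNM, mul_pow, h.norm_right, Finset.mul_sum]
  refine Finset.sum_le_sum fun i _ => ?_
  by_cases hi : (i : ℕ) < m
  · simp [hy i hi]
  · have := hσ i (not_lt.1 hi)
    gcongr

/-- Squareness is essential: for `N < M` the unpaired left singular vectors lie in the kernel of
`Aᵀ`. -/
theorem le_norm_transpose_apply_of_mem_orthogonal (h : IsSVD A U σ V) (hNM : N = M) (hm : m ≤ N)
    {β : ℝ} (hβ : 0 ≤ β) (hσ : ∀ i : Fin N, m ≤ (i : ℕ) → β ≤ σ i)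
    (x : EuclideanSpace ℝ (Fin M)) (hx : x ∈ (columnSpace (firstColumns (hm.trans hNM.le) U))ᗮ) :
    β * ‖x‖ ≤ ‖Matrix.toEuclideanLin Aᵀ x‖ := by
  subst hNM
  rw [mem_columnSpace_firstColumns_orthogonal_iff] at hx
  refine le_of_sq_le_sq ?_ (norm_nonneg _)
  rw [h.norm_transpose_apply_sq le_rfl, mul_pow, h.norm_left, Finset.mul_sum]
  refine Finset.sum_le_sum fun i _ => ?_
  by_cases hi : (i : ℕ) < m
  · simp [hx i hi]
  · have := hσ i (not_lt.1 hi)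
    simp only [Fin.castLE_rfl, id]
    gcongr

/-- The deflated shifted augmented operator is bounded below. -/
theorem le_norm_augmented_of_mem_orthogonal (h : IsSVD A U σ V) (hNM : N ≤ M) (hm : m ≤ N)
    {τ d : ℝ} (hd : 0 ≤ d) (hdτ : d ≤ τ) (hσ : ∀ i : Fin N, m ≤ (i : ℕ) → d ≤ |σ i - τ|)
    (x : EuclideanSpace ℝ (Fin M)) (hx : x ∈ (columnSpace (firstColumns (hm.trans hNM) U))ᗮ)
    (y : EuclideanSpace ℝ (Fin N)) (hy : y ∈ (columnSpace (firstColumns hm V))ᗮ) :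
    d ^ 2 * (‖x‖ ^ 2 + ‖y‖ ^ 2) ≤ ‖Matrix.toEuclideanLin A y - τ • x‖ ^ 2 +
      ‖Matrix.toEuclideanLin Aᵀ x - τ • y‖ ^ 2 := by
  rw [mem_columnSpace_firstColumns_orthogonal_iff] at hx hy
  have hτ : 0 ≤ τ := hd.trans hdτ
  rw [h.norm_left, h.norm_right, h.norm_left, h.norm_right]
  simp only [map_sub, map_smul, PiLp.sub_apply, PiLp.smul_apply, smul_eq_mul, h.right_coord hNM]
  rw [Fin.sum_univ_eq_sum_castLE_add hNM,
    Fin.sum_univ_eq_sum_castLE_add hNM fun i => (_ - τ * Matrix.toEuclideanLin Uᵀ x i) ^ 2]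
  have k1 : ∑ j, d ^ 2 * (Matrix.toEuclideanLin Uᵀ x (Fin.castLE hNM j) ^ 2 +
      Matrix.toEuclideanLin Vᵀ y j ^ 2) ≤ ∑ j, ((Matrix.toEuclideanLin Uᵀ
        (Matrix.toEuclideanLin A y) (Fin.castLE hNM j) -
          τ * Matrix.toEuclideanLin Uᵀ x (Fin.castLE hNM j)) ^ 2 +
        (σ j * Matrix.toEuclideanLin Uᵀ x (Fin.castLE hNM j) -
          τ * Matrix.toEuclideanLin Vᵀ y j) ^ 2) := by
    refine Finset.sum_le_sum fun i _ => ?_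
    rw [h.left_coord_castLE hNM]
    by_cases hi : (i : ℕ) < m
    · simp [hx (Fin.castLE hNM i) hi, hy i hi]
    · have h1 := pow_le_pow_left₀ hd (hσ i (not_lt.1 hi)) 2
      rw [sq_abs] at h1
      set p := Matrix.toEuclideanLin Uᵀ x (Fin.castLE hNM i)
      set q := Matrix.toEuclideanLin Vᵀ y i
      have h2 := mul_le_mul_of_nonneg_right h1 (add_nonneg (sq_nonneg p) (sq_nonneg q))
      -- `(σ q - τ p)² + (σ p - τ q)² = (σ - τ)² (p² + q²) + 2 σ τ (p - q)²`.
      nlinarith [mul_nonneg (mul_nonneg hτ (h.nonneg i)) (sq_nonneg (p - q))]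
  -- On an unpaired coordinate the operator is `-τ`; this is where `d ≤ τ` enters.
  have k2 : ∑ i : Fin M, d ^ 2 * (if N ≤ (i : ℕ) then Matrix.toEuclideanLin Uᵀ x i ^ 2 else 0) ≤
      ∑ i : Fin M, if N ≤ (i : ℕ) then (Matrix.toEuclideanLin Uᵀ (Matrix.toEuclideanLin A y) i -
        τ * Matrix.toEuclideanLin Uᵀ x i) ^ 2 else 0 := by
    refine Finset.sum_le_sum fun i _ => ?_
    split_ifs with hi
    · rw [h.left_coord_of_le y i hi, zero_sub, neg_sq, mul_pow]
      gcongr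
    · simp
  rw [← Finset.mul_sum, Finset.sum_add_distrib, Finset.sum_add_distrib] at k1
  rw [← Finset.mul_sum] at k2
  linarith

end JDSVD.IsSVD

/-! ### Comparing the ordering by distance to the target with the ordering by size -/

section Ordering

variable {N m : ℕ} (σ : Fin N → ℝ)

/-- Counting bounds replace the sorting permutation, so that the two orderings can be compared by
cardinality. -/
theorem card_lt_kthSmallest_le (k : Fin N) :
    (Finset.univ.filter fun i => σ i < kthSmallest σ k).card ≤ k := by
  rw [← Fin.card_Iio k, ← Finset.card_image_of_injective (Finset.Iio k) (Tuple.sort σ).injective]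
  refine Finset.card_le_card fun i hi => ?_
  rw [Finset.mem_filter] at hi
  refine Finset.mem_image.2 ⟨(Tuple.sort σ).symm i, ?_, by simp⟩
  rw [Finset.mem_Iio]
  by_contra h
  have := Tuple.monotone_sort σ (not_lt.1 h)
  simp only [Function.comp_apply, Equiv.apply_symm_apply] at this
  exact absurd hi.2 (not_lt.2 this)

theorem le_card_le_kthSmallest (k : Fin N) :
    (k : ℕ) + 1 ≤ (Finset.univ.filter fun i => σ i ≤ kthSmallest σ k).card := by
  rw [← Fin.card_Iic k, ← Finset.card_image_of_injective _ (Tuple.sort σ).injective]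
  refine Finset.card_le_card fun i hi => ?_
  obtain ⟨l, hl, rfl⟩ := Finset.mem_image.1 hi
  exact Finset.mem_filter.2 ⟨Finset.mem_univ _, Tuple.monotone_sort σ (Finset.mem_Iic.1 hl)⟩

theorem card_kthLargest_lt_le (k : Fin N) :
    (Finset.univ.filter fun i => kthLargest σ k < σ i).card ≤ k := by
  have hk : (Finset.Ioi k.rev).card = k := by
    rw [Fin.card_Ioi, Fin.val_rev]; have := k.2; omega
  conv_rhs => rw [← hk]
  rw [← Finset.card_image_of_injective (Finset.Ioi k.rev) (Tuple.sort σ).injective]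
  refine Finset.card_le_card fun i hi => ?_
  rw [Finset.mem_filter] at hi
  refine Finset.mem_image.2 ⟨(Tuple.sort σ).symm i, ?_, by simp⟩
  rw [Finset.mem_Ioi]
  by_contra h
  have := Tuple.monotone_sort σ (not_lt.1 h)
  simp only [Function.comp_apply, Equiv.apply_symm_apply] at this
  exact absurd hi.2 (not_lt.2 this)

theorem le_card_kthLargest_le (k : Fin N) :
    (k : ℕ) + 1 ≤ (Finset.univ.filter fun i => kthLargest σ k ≤ σ i).card := by
  have hk : (Finset.Ici k.rev).card = k + 1 := by
    rw [Fin.card_Ici, Fin.val_rev]; have := k.2; omega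
  rw [← hk, ← Finset.card_image_of_injective _ (Tuple.sort σ).injective]
  refine Finset.card_le_card fun i hi => ?_
  obtain ⟨l, hl, rfl⟩ := Finset.mem_image.1 hi
  exact Finset.mem_filter.2 ⟨Finset.mem_univ _, Tuple.monotone_sort σ (Finset.mem_Ici.1 hl)⟩

theorem le_kthLargest_zero (hN : 0 < N) (i : Fin N) : σ i ≤ kthLargest σ ⟨0, hN⟩ := by
  have h := card_kthLargest_lt_le σ ⟨0, hN⟩
  simp only [nonpos_iff_eq_zero, Finset.card_eq_zero, Finset.filter_eq_empty_iff] at h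
  exact not_lt.1 (h (Finset.mem_univ i))

theorem kthSmallest_zero_le (hN : 0 < N) (i : Fin N) : kthSmallest σ ⟨0, hN⟩ ≤ σ i := by
  have h := card_lt_kthSmallest_le σ ⟨0, hN⟩
  simp only [nonpos_iff_eq_zero, Finset.card_eq_zero, Finset.filter_eq_empty_iff] at h
  exact not_lt.1 (h (Finset.mem_univ i))

variable {σ}

/-- Pigeonhole: `m + 1` indices cannot all be below `m`. -/
theorem Monotone.le_of_succ_le_card_filter {d : Fin N → ℝ} (hd : Monotone d) (hm : m < N)
    {P : Fin N → Prop} [DecidablePred P] (hP : m + 1 ≤ (Finset.univ.filter P).card) {c : ℝ}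
    (h : ∀ i, P i → d i ≤ c) : d ⟨m, hm⟩ ≤ c := by
  by_contra hc
  have hsub : Finset.univ.filter P ⊆ Finset.Iio ⟨m, hm⟩ := by
    intro i hi
    rw [Finset.mem_Iio]
    by_contra hlt
    exact hc ((hd (not_lt.1 hlt)).trans (h i (Finset.mem_filter.1 hi).2))
  have := Finset.card_le_card hsub
  rw [Fin.card_Iio] at this
  simp at this
  omega

/-- If `P i` held, the whole initial segment up to `i`, with more than `m` elements, would satisfy
`P`. -/
theorem not_of_card_filter_le {P : Fin N → Prop} [DecidablePred P]
    (hP : (Finset.univ.filter P).card ≤ m) (h : ∀ i k, k ≤ i → P i → P k) (i : Fin N)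
    (hi : m ≤ (i : ℕ)) : ¬ P i := by
  intro hPi
  have hsub : Finset.Iic i ⊆ Finset.univ.filter P := fun k hk =>
    Finset.mem_filter.2 ⟨Finset.mem_univ _, h i k (Finset.mem_Iic.1 hk) hPi⟩
  have := Finset.card_le_card hsub
  rw [Fin.card_Iic] at this
  omega

/-- A target above the midpoint selects the largest values first. -/
theorem le_kthLargest_of_midpoint_lt {τ : ℝ} (hσ : Monotone fun i => |σ i - τ|) (hm : m < N)
    (h : (kthLargest σ ⟨0, Nat.zero_lt_of_lt hm⟩ + kthLargest σ ⟨m, hm⟩) / 2 < τ) (i : Fin N)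
    (hi : m ≤ (i : ℕ)) : σ i ≤ kthLargest σ ⟨m, hm⟩ := by
  refine not_lt.1 (not_of_card_filter_le (card_kthLargest_lt_le σ ⟨m, hm⟩) ?_ i hi)
  intro i k hk hlt
  have h1 : |σ k - τ| ≤ |σ i - τ| := hσ hk
  have h2 := le_kthLargest_zero σ (Nat.zero_lt_of_lt hm) i
  -- The midpoint condition makes even the largest value exceed `τ` by less than this gap.
  have h3 : |σ i - τ| < τ - kthLargest σ ⟨m, hm⟩ := by rw [abs_lt]; constructor <;> linarith
  have h4 := (abs_lt.1 (h1.trans_lt h3)).1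
  linarith

/-- A target below the midpoint selects the smallest values first. -/
theorem kthSmallest_le_of_lt_midpoint {τ : ℝ} (hσ : Monotone fun i => |σ i - τ|) (hm : m < N)
    (h : τ < (kthSmallest σ ⟨0, Nat.zero_lt_of_lt hm⟩ + kthSmallest σ ⟨m, hm⟩) / 2) (i : Fin N)
    (hi : m ≤ (i : ℕ)) : kthSmallest σ ⟨m, hm⟩ ≤ σ i := by
  refine not_lt.1 (not_of_card_filter_le (card_lt_kthSmallest_le σ ⟨m, hm⟩) ?_ i hi)
  intro i k hk hlt
  have h1 : |σ k - τ| ≤ |σ i - τ| := hσ hk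
  have h2 := kthSmallest_zero_le σ (Nat.zero_lt_of_lt hm) i
  have h3 : |σ i - τ| < kthSmallest σ ⟨m, hm⟩ - τ := by rw [abs_lt]; constructor <;> linarith
  have h4 := (abs_lt.1 (h1.trans_lt h3)).2
  linarith

/-- At least `m + 1` values lie between the two order statistics, hence no farther from `τ` than the
farther endpoint. -/
theorem abs_sub_le_max_largest {τ : ℝ} (hσ : Monotone fun i => |σ i - τ|) (hm : m < N) :
    |σ ⟨m, hm⟩ - τ| ≤ max (kthLargest σ ⟨0, Nat.zero_lt_of_lt hm⟩ - τ)
      (τ - kthLargest σ ⟨m, hm⟩) := by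
  refine hσ.le_of_succ_le_card_filter hm (le_card_kthLargest_le σ ⟨m, hm⟩) fun i hi => ?_
  have := le_kthLargest_zero σ (Nat.zero_lt_of_lt hm) i
  rw [abs_le', neg_sub]
  exact ⟨le_max_of_le_left (by linarith), le_max_of_le_right (by linarith)⟩

theorem abs_sub_le_max_smallest {τ : ℝ} (hσ : Monotone fun i => |σ i - τ|) (hm : m < N) :
    |σ ⟨m, hm⟩ - τ| ≤ max (kthSmallest σ ⟨m, hm⟩ - τ)
      (τ - kthSmallest σ ⟨0, Nat.zero_lt_of_lt hm⟩) := by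
  refine hσ.le_of_succ_le_card_filter hm (le_card_le_kthSmallest σ ⟨m, hm⟩) fun i hi => ?_
  have := kthSmallest_zero_le σ (Nat.zero_lt_of_lt hm) i
  rw [abs_le', neg_sub]
  exact ⟨le_max_of_le_left (by linarith), le_max_of_le_right (by linarith)⟩

end Ordering

/-! ### Eigenvalues of the correction equation -/

section Correction

variable {M N m : ℕ} {A : Matrix (Fin M) (Fin N) ℝ} {τ : ℝ} {X : Matrix (Fin M) (Fin m) ℝ}
  {Y : Matrix (Fin N) (Fin m) ℝ}

theorem one_sub_mul_transpose_mul_self {n : ℕ} {C : Matrix (Fin n) (Fin m) ℝ} (hC : Cᵀ * C = 1) :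
    (1 - C * Cᵀ) * (1 - C * Cᵀ) = 1 - C * Cᵀ := by
  have : C * Cᵀ * (C * Cᵀ) = C * Cᵀ := by
    rw [Matrix.mul_assoc, ← Matrix.mul_assoc Cᵀ, hC, Matrix.one_mul]
  rw [Matrix.mul_sub, Matrix.sub_mul, Matrix.sub_mul, this]
  simp

theorem deflationProjector_transpose : (deflationProjector X Y)ᵀ = deflationProjector X Y := by
  simp [deflationProjector, Matrix.fromBlocks_transpose]

theorem deflationProjector_mul_self (hX : Xᵀ * X = 1) (hY : Yᵀ * Y = 1) :
    deflationProjector X Y * deflationProjector X Y = deflationProjector X Y := by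
  simp [deflationProjector, Matrix.fromBlocks_multiply, one_sub_mul_transpose_mul_self hX,
    one_sub_mul_transpose_mul_self hY]

theorem correctionMatrix_transpose : (correctionMatrix A τ X Y)ᵀ = correctionMatrix A τ X Y := by
  have : (shiftedAugmented A τ)ᵀ = shiftedAugmented A τ := by
    simp [shiftedAugmented, Matrix.fromBlocks_transpose]
  rw [correctionMatrix, Matrix.transpose_mul, Matrix.transpose_mul, deflationProjector_transpose,
    this, Matrix.mul_assoc]

/-- `(f, g)` is an eigenvector of the compressed augmented matrix `[0, A; Aᵀ, 0]` with eigenvalue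
`μ`. -/
structure IsCompressedEigenpair (A : Matrix (Fin M) (Fin N) ℝ) (X : Matrix (Fin M) (Fin m) ℝ)
    (Y : Matrix (Fin N) (Fin m) ℝ) (μ : ℝ) (f : EuclideanSpace ℝ (Fin M))
    (g : EuclideanSpace ℝ (Fin N)) : Prop where
  ne_zero : f ≠ 0 ∨ g ≠ 0
  left_mem : f ∈ (columnSpace X)ᗮ
  right_mem : g ∈ (columnSpace Y)ᗮ
  left_eq : (columnSpace X)ᗮ.starProjection (Matrix.toEuclideanLin A g) = μ • f
  right_eq : (columnSpace Y)ᗮ.starProjection (Matrix.toEuclideanLin Aᵀ f) = μ • g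

/-- On the range of the projector the term `-τ I` is unaffected by the compression, so it only
shifts the eigenvalue. -/
theorem exists_isCompressedEigenpair (hX : Xᵀ * X = 1) (hY : Yᵀ * Y = 1) {c : ℝ}
    {x : EuclideanSpace ℝ (Fin M ⊕ Fin N)} (hx0 : x ≠ 0)
    (hx : Matrix.toEuclideanLin (deflationProjector X Y) x = x)
    (hc : Matrix.toEuclideanLin (correctionMatrix A τ X Y) x = c • x) :
    ∃ f g, IsCompressedEigenpair A X Y (c + τ) f g := by
  set f : EuclideanSpace ℝ (Fin M) := WithLp.toLp 2 fun i => x (Sum.inl i) with hf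
  set g : EuclideanSpace ℝ (Fin N) := WithLp.toLp 2 fun i => x (Sum.inr i) with hg
  rw [correctionMatrix, toEuclideanLin_mul_apply, toEuclideanLin_mul_apply, hx] at hc
  have hblock : ∀ z : EuclideanSpace ℝ (Fin M ⊕ Fin N),
      (∀ i, Matrix.toEuclideanLin (deflationProjector X Y) z (Sum.inl i) =
        (columnSpace X)ᗮ.starProjection (WithLp.toLp 2 fun i => z (Sum.inl i)) i) ∧
      (∀ i, Matrix.toEuclideanLin (deflationProjector X Y) z (Sum.inr i) =
        (columnSpace Y)ᗮ.starProjection (WithLp.toLp 2 fun i => z (Sum.inr i)) i) := by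
    intro z
    rw [Matrix.toLpLin_apply, deflationProjector, Matrix.fromBlocks_mulVec]
    constructor <;> intro i
    · rw [starProjection_columnSpace_orthogonal hX]
      simp [Matrix.toLpLin_apply, Matrix.sub_mulVec, Function.comp_def]
    · rw [starProjection_columnSpace_orthogonal hY]
      simp [Matrix.toLpLin_apply, Matrix.sub_mulVec, Function.comp_def]
  have hS1 : (WithLp.toLp 2 fun i => Matrix.toEuclideanLin (shiftedAugmented A τ) x (Sum.inl i)) =
      Matrix.toEuclideanLin A g - τ • f := by
    ext i
    simp [Matrix.toLpLin_apply, shiftedAugmented, Matrix.fromBlocks_mulVec, Matrix.neg_mulVec,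
      Matrix.smul_mulVec, hf, hg, Function.comp_def]
    ring
  have hS2 : (WithLp.toLp 2 fun i => Matrix.toEuclideanLin (shiftedAugmented A τ) x (Sum.inr i)) =
      Matrix.toEuclideanLin Aᵀ f - τ • g := by
    ext i
    simp [Matrix.toLpLin_apply, shiftedAugmented, Matrix.fromBlocks_mulVec, Matrix.neg_mulVec,
      Matrix.smul_mulVec, hf, hg, Function.comp_def]
    ring
  have hPf : (columnSpace X)ᗮ.starProjection f = f := by
    ext i
    rw [← (hblock x).1 i, hx]
  have hPg : (columnSpace Y)ᗮ.starProjection g = g := by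
    ext i
    rw [← (hblock x).2 i, hx]
  have h1 : (columnSpace X)ᗮ.starProjection (Matrix.toEuclideanLin A g - τ • f) = c • f := by
    ext i
    rw [← hS1, ← (hblock _).1 i, hc]
    rfl
  have h2 : (columnSpace Y)ᗮ.starProjection (Matrix.toEuclideanLin Aᵀ f - τ • g) = c • g := by
    ext i
    rw [← hS2, ← (hblock _).2 i, hc]
    rfl
  rw [map_sub, map_smul, hPf, sub_eq_iff_eq_add, ← add_smul] at h1
  rw [map_sub, map_smul, hPg, sub_eq_iff_eq_add, ← add_smul] at h2
  refine ⟨f, g, ?_, Submodule.starProjection_eq_self_iff.1 hPf,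
    Submodule.starProjection_eq_self_iff.1 hPg, h1, h2⟩
  by_contra! h
  apply hx0
  ext (i | i)
  · exact congrArg (fun z : EuclideanSpace ℝ (Fin M) => z i) h.1
  · exact congrArg (fun z : EuclideanSpace ℝ (Fin N) => z i) h.2

namespace IsCompressedEigenpair

variable {μ : ℝ} {f : EuclideanSpace ℝ (Fin M)} {g : EuclideanSpace ℝ (Fin N)}
  {U : Matrix (Fin M) (Fin M) ℝ} {σ : Fin N → ℝ} {V : Matrix (Fin N) (Fin N) ℝ} {s t : ℝ}

/-- Both `μ ‖f‖²` and `μ ‖g‖²` equal `⟪f, A g⟫`. Hence a norm bound for the compression of `A`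
becomes a bound for `|μ|`. -/
theorem norm_eq (h : IsCompressedEigenpair A X Y μ f g) (hμ : μ ≠ 0) : ‖f‖ = ‖g‖ := by
  have h1 : μ * ‖f‖ ^ 2 = inner ℝ f (Matrix.toEuclideanLin A g) := by
    rw [← real_inner_self_eq_norm_sq, ← real_inner_smul_right, ← h.left_eq,
      ← Submodule.inner_starProjection_left_eq_right,
      Submodule.starProjection_eq_self_iff.2 h.left_mem]
  have h2 : μ * ‖g‖ ^ 2 = inner ℝ (Matrix.toEuclideanLin Aᵀ f) g := by
    rw [← real_inner_self_eq_norm_sq, ← real_inner_smul_left, ← h.right_eq,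
      Submodule.inner_starProjection_left_eq_right,
      Submodule.starProjection_eq_self_iff.2 h.right_mem]
  rw [← inner_toEuclideanLin_right, ← h1] at h2
  exact ((sq_eq_sq₀ (norm_nonneg _) (norm_nonneg _)).1 (mul_left_cancel₀ hμ h2)).symm

theorem norm_pos (h : IsCompressedEigenpair A X Y μ f g) (hμ : μ ≠ 0) : 0 < ‖g‖ := by
  rcases h.ne_zero with h0 | h0
  · rw [← h.norm_eq hμ]; exact norm_pos_iff.2 h0
  · exact norm_pos_iff.2 h0

theorem abs_le (h : IsCompressedEigenpair A X Y μ f g) (hA : IsSVD A U σ V) (hNM : N ≤ M)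
    (hm : m ≤ N) (hs : SubspaceGapLE (columnSpace X) (columnSpace (firstColumns (hm.trans hNM) U)) s)
    (ht : SubspaceGapLE (columnSpace Y) (columnSpace (firstColumns hm V)) t)
    {β : ℝ} (hβ : 0 ≤ β) (hσ : ∀ i : Fin N, m ≤ (i : ℕ) → σ i ≤ β) :
    |μ| ≤ β + ‖A‖ * (s + t) ^ 2 := by
  rcases eq_or_ne μ 0 with rfl | hμ
  · rw [abs_zero]; positivity
  have h1 := norm_compression_le hs ht (norm_nonneg A) (norm_toEuclideanLin_apply_le A)
    (hA.apply_mem_columnSpace hNM hm) hβ (hA.norm_apply_le_of_mem_orthogonal hNM hm hβ hσ)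
    h.right_mem
  rw [h.left_eq, norm_smul, h.norm_eq hμ, Real.norm_eq_abs] at h1
  exact le_of_mul_le_mul_right h1 (h.norm_pos hμ)

/-- For `μ = 0` the lower bound for `A` forces `g = 0`; when `N = M` the one for `Aᵀ` also forces `f
= 0`, a contradiction. -/
theorem le_abs (h : IsCompressedEigenpair A X Y μ f g) (hA : IsSVD A U σ V) (hNM : N ≤ M)
    (hm : m ≤ N) (hs : SubspaceGapLE (columnSpace X) (columnSpace (firstColumns (hm.trans hNM) U)) s)
    (ht : SubspaceGapLE (columnSpace Y) (columnSpace (firstColumns hm V)) t)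
    {β : ℝ} (hβ : 0 < β - ‖A‖ * (s + t) ^ 2) (hβA : β ≤ ‖A‖)
    (hσ : ∀ i : Fin N, m ≤ (i : ℕ) → β ≤ σ i) :
    (μ = 0 ∧ N < M) ∨ β - ‖A‖ * (s + t) ^ 2 ≤ |μ| := by
  have hβ0 : 0 ≤ β := by
    have : 0 ≤ ‖A‖ * (s + t) ^ 2 := by positivity
    linarith
  have h1 := le_norm_compression hs ht (norm_nonneg A) (norm_toEuclideanLin_apply_le A)
    (hA.apply_mem_columnSpace hNM hm) (hA.apply_mem_columnSpace_orthogonal hNM hm) hβ0 hβA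
    (hA.le_norm_apply_of_mem_orthogonal hNM hm hβ0 hσ) h.right_mem
  rw [h.left_eq, norm_smul, Real.norm_eq_abs] at h1
  rcases eq_or_ne μ 0 with rfl | hμ
  · refine Or.inl ⟨rfl, lt_of_le_of_ne hNM fun hNM' => ?_⟩
    rw [abs_zero, zero_mul] at h1
    have hg : g = 0 := norm_eq_zero.1
      (le_antisymm (nonpos_of_mul_nonpos_right h1 hβ) (norm_nonneg g))
    have h2 := le_norm_compression ht hs (norm_nonneg A)
      (fun x => (norm_toEuclideanLin_apply_le Aᵀ x).trans_eq (by rw [norm_transpose_eq]))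
      (hA.transpose_apply_mem_columnSpace hNM hm)
      (hA.transpose_apply_mem_columnSpace_orthogonal hNM hm) hβ0 hβA
      (hA.le_norm_transpose_apply_of_mem_orthogonal hNM' hm hβ0 hσ) h.left_mem
    rw [h.right_eq, zero_smul, norm_zero, add_comm t s] at h2
    have hf : f = 0 := norm_eq_zero.1
      (le_antisymm (nonpos_of_mul_nonpos_right h2 hβ) (norm_nonneg f))
    exact h.ne_zero.elim (· hf) (· hg)
  · rw [h.norm_eq hμ] at h1
    exact Or.inr (le_of_mul_le_mul_right h1 (h.norm_pos hμ))

theorem le_abs_sub {c d : ℝ} (h : IsCompressedEigenpair A X Y (c + τ) f g) (hA : IsSVD A U σ V)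
    (hNM : N ≤ M) (hm : m ≤ N)
    (hs : SubspaceGapLE (columnSpace X) (columnSpace (firstColumns (hm.trans hNM) U)) s)
    (ht : SubspaceGapLE (columnSpace Y) (columnSpace (firstColumns hm V)) t)
    (hd : 0 ≤ d) (hdτ : d ≤ τ) (hdA : d + τ ≤ ‖A‖)
    (hσ : ∀ i : Fin N, m ≤ (i : ℕ) → d ≤ |σ i - τ|) :
    d - ‖A‖ * (s + t) ^ 2 ≤ |c| :=
  le_abs_eigenvalue_of_compression hs ht (norm_nonneg A) (norm_toEuclideanLin_apply_le A)
    (fun x => (norm_toEuclideanLin_apply_le Aᵀ x).trans_eq (by rw [norm_transpose_eq]))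
    (hA.apply_mem_columnSpace hNM hm) (hA.apply_mem_columnSpace_orthogonal hNM hm)
    (hA.transpose_apply_mem_columnSpace hNM hm)
    (hA.transpose_apply_mem_columnSpace_orthogonal hNM hm) (hd.trans hdτ) hdA
    (hA.le_norm_augmented_of_mem_orthogonal hNM hm hd hdτ hσ)
    h.left_mem h.right_mem h.ne_zero h.left_eq h.right_eq

end IsCompressedEigenpair

/-- Residual bound for the correction equation from a residual polynomial that is small at the
eigenvalues. -/
theorem JDSVD.IsMinresIterate.correction_residual_le (hX : Xᵀ * X = 1) (hY : Yᵀ * Y = 1)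
    {r w : EuclideanSpace ℝ (Fin M ⊕ Fin N)} {j : ℕ} (hr : r ≠ 0)
    (hrperp : Matrix.toEuclideanLin (deflationProjector X Y) r = r)
    (hw : IsMinresIterate (correctionMatrix A τ X Y) r j w) {q : Polynomial ℝ}
    (hq : q.natDegree ≤ j) (hq0 : q.eval 0 = 1) {ε : ℝ} (hε : 0 ≤ ε)
    (h : ∀ c f g, IsCompressedEigenpair A X Y (c + τ) f g → |q.eval c| ≤ ε) :
    ‖linResidual (correctionMatrix A τ X Y) r w‖ / ‖r‖ ≤ ε := by
  have hQQ := deflationProjector_mul_self hX hY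
  refine hw.norm_linResidual_div_le hr correctionMatrix_transpose deflationProjector_transpose hQQ
    (by rw [correctionMatrix, Matrix.mul_assoc, hQQ])
    (by rw [correctionMatrix, ← Matrix.mul_assoc, ← Matrix.mul_assoc, hQQ])
    hrperp hq hq0 hε fun c x hx0 hx hc => ?_
  obtain ⟨f, g, hfg⟩ := exists_isCompressedEigenpair hX hY hx0 hx hc
  exact h c f g hfg

end Correction

/-! ### The three convergence bounds -/

theorem theorem9 {M N m : ℕ} (hNM : N ≤ M) (hm : 1 ≤ m) (hmN : m < N)
    (A : Matrix (Fin M) (Fin N) ℝ) (τ : ℝ) (hτ : 0 ≤ τ)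
    -- a singular value decomposition, labeled by the distance to the target `τ`
    (U : Matrix (Fin M) (Fin M) ℝ) (σ : Fin N → ℝ) (V : Matrix (Fin N) (Fin N) ℝ)
    (hSVD : IsSVD A U σ V) (hσ : Monotone fun i => |σ i - τ|)
    -- approximate left and right singular vectors
    (Ut : Matrix (Fin M) (Fin m) ℝ) (Vt : Matrix (Fin N) (Fin m) ℝ)
    (hUt : Utᵀ * Ut = 1) (hVt : Vtᵀ * Vt = 1)
    -- the right-hand side is `-r`
    (r : EuclideanSpace ℝ (Fin M ⊕ Fin N)) (hr : r ≠ 0)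
    (hrperp : Matrix.toEuclideanLin (deflationProjector Ut Vt) r = r)
    -- the extreme and the `(m+1)`-th largest and smallest singular values
    (σmax σmin σmaxm σminm : ℝ)
    (hσmax : σmax = kthLargest σ ⟨0, Nat.zero_lt_of_lt hmN⟩)
    (hσmin : σmin = kthSmallest σ ⟨0, Nat.zero_lt_of_lt hmN⟩)
    (hσmaxm : σmaxm = kthLargest σ ⟨m, hmN⟩)
    (hσminm : σminm = kthSmallest σ ⟨m, hmN⟩)
    -- the size of the subspace errors
    (δ : ℝ)
    (hδ : δ = ‖A‖ *
      (‖sinCanonicalAngles m (columnSpace Ut)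
          (columnSpace (firstColumns (hmN.le.trans hNM) U))‖ +
        ‖sinCanonicalAngles m (columnSpace Vt)
          (columnSpace (firstColumns hmN.le V))‖) ^ 2)
    (hδlt : δ < |σ ⟨m, hmN⟩ - τ|)
    -- a MINRES iterate
    (j : ℕ) (w : EuclideanSpace ℝ (Fin M ⊕ Fin N))
    (hw : IsMinresIterate (correctionMatrix A τ Ut Vt) r j w) :
    ((σmax + σmaxm) / 2 < τ →
      ‖linResidual (correctionMatrix A τ Ut Vt) r w‖ / ‖r‖ ≤
        2 * (1 - 2 / (1 + √((τ + σmaxm + δ) / (τ - σmaxm - δ)))) ^ j) ∧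
    (0 < τ → σmin ≤ τ → τ < (σmin + σminm) / 2 →
      ‖linResidual (correctionMatrix A τ Ut Vt) r w‖ / ‖r‖ ≤
        2 * ((σmax + δ) / τ) ^ (min 1 (M - N)) *
          (1 - 2 / (1 + √(((σmax + δ) ^ 2 - τ ^ 2) / ((σminm - δ) ^ 2 - τ ^ 2)))) ^
            ((j - min 1 (M - N)) / 2)) ∧
    ((σmin + σminm) / 2 < τ → τ < (σmax + σmaxm) / 2 →
      ‖linResidual (correctionMatrix A τ Ut Vt) r w‖ / ‖r‖ ≤
        2 * (1 - 2 / (1 + (σmax + τ + δ) / (|σ ⟨m, hmN⟩ - τ| - δ))) ^ (j / 2)) := by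

  have hN0 : 0 < N := Nat.zero_lt_of_lt hmN
  have hs := subspaceGapLE_norm_sinCanonicalAngles hm (finrank_columnSpace hUt)
    (finrank_columnSpace (firstColumns_transpose_mul_self (hmN.le.trans hNM)
      hSVD.left_transpose_mul_self))
  have ht := subspaceGapLE_norm_sinCanonicalAngles hm (finrank_columnSpace hVt)
    (finrank_columnSpace (firstColumns_transpose_mul_self hmN.le hSVD.right_transpose_mul_self))
  set s := ‖sinCanonicalAngles m (columnSpace Ut)
    (columnSpace (firstColumns (hmN.le.trans hNM) U))‖
  set t := ‖sinCanonicalAngles m (columnSpace Vt) (columnSpace (firstColumns hmN.le V))‖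
  have hδ0 : 0 ≤ δ := by rw [hδ]; positivity
  have hσmax_le : ∀ i, σ i ≤ σmax := fun i => hσmax ▸ le_kthLargest_zero σ hN0 i
  have hσmax_norm : σmax ≤ ‖A‖ := hσmax ▸ hSVD.singularValue_le_norm hNM _
  have hσmin0 : 0 ≤ σmin := hσmin ▸ hSVD.nonneg _
  have hσmaxm0 : 0 ≤ σmaxm := hσmaxm ▸ hSVD.nonneg _
  have hσminm_le : σminm ≤ σmax := hσminm ▸ hσmax_le _
  have hσmax0 : 0 ≤ σmax := (hSVD.nonneg ⟨0, hN0⟩).trans (hσmax_le _)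
  have hlarge := abs_sub_le_max_largest hσ hmN
  have hsmall := abs_sub_le_max_smallest hσ hmN
  rw [← hσmax, ← hσmaxm] at hlarge
  rw [← hσmin, ← hσminm] at hsmall
  have hupper : ∀ c f g, IsCompressedEigenpair A Ut Vt (c + τ) f g → |c + τ| ≤ σmax + δ :=
    fun c f g h => hδ ▸ h.abs_le hSVD hNM hmN.le hs ht hσmax0 fun i _ => hσmax_le i
  refine ⟨fun hτ1 => ?_, fun hτ0 _ hτ2 => ?_, fun hτ1 hτ2 => ?_⟩
  · have hgap : |σ ⟨m, hmN⟩ - τ| ≤ τ - σmaxm := hlarge.trans (max_le (by linarith) le_rfl)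
    obtain ⟨q, hqd, hq0, hq⟩ := exists_polynomial_abs_eval_le
      (a := τ - σmaxm - δ) (b := τ + σmaxm + δ) (by linarith) (by linarith) j
    -- Here `|c + τ| ≤ σmaxm + δ < τ`, so every `-c` lies in the interval of `q`.
    refine hw.correction_residual_le hUt hVt hr hrperp (q := q.comp (-Polynomial.X)) ?_ ?_
      ((abs_nonneg _).trans (hq _ le_rfl (by linarith))) fun c f g h => ?_
    · exact Polynomial.natDegree_comp_le.trans (by simpa using hqd)
    · simpa using hq0
    · have h1 := h.abs_le hSVD hNM hmN.le hs ht hσmaxm0 fun i hi =>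
        hσmaxm ▸ le_kthLargest_of_midpoint_lt hσ hmN (by rwa [← hσmax, ← hσmaxm]) i hi
      rw [← hδ, abs_le] at h1
      simpa using hq (-c) (by linarith) (by linarith)
  · have hgap : |σ ⟨m, hmN⟩ - τ| ≤ σminm - τ := hsmall.trans (max_le le_rfl (by linarith))
    have hγ : τ < σminm - δ := by linarith
    have ha : 0 < (σminm - δ) ^ 2 - τ ^ 2 := sub_pos.2 (by gcongr)
    have hab : (σminm - δ) ^ 2 - τ ^ 2 ≤ (σmax + δ) ^ 2 - τ ^ 2 := by
      gcongr
      · linarith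
      · linarith
    obtain ⟨q, hqd, hq0, hq⟩ := exists_polynomial_abs_eval_le ha hab ((j - min 1 (M - N)) / 2)
    set ρ := (1 - 2 / (1 + √(((σmax + δ) ^ 2 - τ ^ 2) / ((σminm - δ) ^ 2 - τ ^ 2)))) ^
      ((j - min 1 (M - N)) / 2) with hρ
    have hρ0 : 0 ≤ 2 * ρ := (abs_nonneg _).trans (hq _ le_rfl hab)
    have hlower : ∀ c f g, IsCompressedEigenpair A Ut Vt (c + τ) f g →
        (c + τ = 0 ∧ N < M) ∨ σminm - δ ≤ |c + τ| := by
      intro c f g h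
      have h1 := h.le_abs hSVD hNM hmN.le hs ht (β := σminm) (by rw [← hδ]; linarith)
        (hσminm_le.trans hσmax_norm) fun i hi => hσminm ▸
          kthSmallest_le_of_lt_midpoint hσ hmN (by rwa [← hσmin, ← hσminm]) i hi
      rwa [← hδ] at h1
    have hbound : ∀ c, σminm - δ ≤ |c + τ| → |c + τ| ≤ σmax + δ →
        |q.eval ((c + τ) ^ 2 - τ ^ 2)| ≤ 2 * ρ := by
      intro c h1 h2
      refine hq _ ?_ ?_ <;> rw [← sq_abs (c + τ)] <;> gcongr
      linarith
    -- The inner quadratic is `μ² - τ²`: it vanishes at `c = 0` and maps both branches `±μ` to one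
    -- positive interval.
    set p : Polynomial ℝ := q.comp ((Polynomial.X + Polynomial.C τ) ^ 2 - Polynomial.C (τ ^ 2))
      with hp
    have hpd : p.natDegree ≤ (j - min 1 (M - N)) / 2 * 2 := by
      refine Polynomial.natDegree_comp_le.trans (Nat.mul_le_mul hqd ?_)
      compute_degree
    have hp0 : p.eval 0 = 1 := by simp [hp, hq0]
    have hpe : ∀ c, p.eval c = q.eval ((c + τ) ^ 2 - τ ^ 2) := fun c => by simp [hp]
    have hratio : 1 ≤ (σmax + δ) / τ := by rw [one_le_div hτ0]; linarith
    rcases hNM.eq_or_lt with hMN | hMN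
    · have hjo : min 1 (M - N) = 0 := by omega
      rw [hjo] at hpd ⊢
      rw [pow_zero, mul_one]
      refine hw.correction_residual_le hUt hVt hr hrperp (q := p) (by omega) hp0 hρ0
        fun c f g h => ?_
      rw [hpe]
      refine hbound c ((hlower c f g h).resolve_left fun h1 => ?_) (hupper c f g h)
      omega
    · have hjo : min 1 (M - N) = 1 := by omega
      rw [hjo] at hpd ⊢
      rw [pow_one]
      have hε : 2 * ((σmax + δ) / τ) * ρ = (σmax + δ) / τ * (2 * ρ) := by ring
      rw [hε]
      -- For `j = 0` there is no degree for the extra linear factor. Truncated subtraction makes the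
      -- exponent `0`, and the constant `1` suffices since `(σmax + δ) / τ ≥ 1`.
      rcases Nat.eq_zero_or_pos j with hj | hj
      · have hρ1 : ρ = 1 := by rw [hρ, hj]; simp
        refine hw.correction_residual_le hUt hVt hr hrperp (q := 1) (by simp) (by simp)
          (by positivity) fun c f g h => ?_
        rw [hρ1, Polynomial.eval_one, abs_one]
        linarith
      -- The linear factor equals `μ / τ`: it removes the eigenvalue `μ = 0` and is at most `(σmax +
      -- δ) / τ` in modulus elsewhere.
      · refine hw.correction_residual_le hUt hVt hr hrperp
          (q := (1 + Polynomial.C τ⁻¹ * Polynomial.X) * p) ?_ ?_ (by positivity) fun c f g h => ?_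
        · have h1 : (1 + Polynomial.C τ⁻¹ * Polynomial.X).natDegree ≤ 1 := by compute_degree
          exact (Polynomial.natDegree_mul_le_of_le h1 hpd).trans (by omega)
        · simp [hp0]
        · have h1 : (1 + Polynomial.C τ⁻¹ * Polynomial.X).eval c = (c + τ) / τ := by
            simp; field_simp; ring
          rw [Polynomial.eval_mul, h1, hpe, abs_mul, abs_div, abs_of_pos hτ0]
          rcases hlower c f g h with h2 | h2
          · rw [h2.1, abs_zero, zero_div, zero_mul]; positivity
          · have h3 := hupper c f g h
            have h4 := hbound c h2 h3
            gcongr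
  · set d := |σ ⟨m, hmN⟩ - τ|
    -- The two midpoint conditions give exactly what `le_abs_sub` needs: `d ≤ τ` and `d + τ ≤ σmax ≤
    -- ‖A‖`.
    have hdτ : d ≤ τ := hsmall.trans (max_le (by linarith) (by linarith))
    have hdmax : d ≤ σmax - τ := hlarge.trans (max_le le_rfl (by linarith))
    have hdδ : 0 < d - δ := by linarith
    have hle : d - δ ≤ σmax + τ + δ := by linarith
    have hle2 : (d - δ) ^ 2 ≤ (σmax + τ + δ) ^ 2 := by gcongr
    obtain ⟨q, hqd, hq0, hq⟩ := exists_polynomial_abs_eval_le (pow_pos hdδ 2) hle2 (j / 2)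
    -- The interval for `c²` has squared endpoints, so the square root in the Chebyshev rate
    -- disappears.
    rw [← div_pow, Real.sqrt_sq (div_nonneg (hdδ.le.trans hle) hdδ.le)] at hq
    refine hw.correction_residual_le hUt hVt hr hrperp (q := q.comp (Polynomial.X ^ 2)) ?_ ?_
      ((abs_nonneg _).trans (hq _ le_rfl hle2)) fun c f g h => ?_
    · refine Polynomial.natDegree_comp_le.trans ?_
      rw [Polynomial.natDegree_X_pow]
      omega
    · simpa using hq0
    · have h1 := h.le_abs_sub hSVD hNM hmN.le hs ht (abs_nonneg _) hdτ (by linarith)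
        fun i hi => hσ (show (⟨m, hmN⟩ : Fin N) ≤ i from hi)
      rw [← hδ] at h1
      have h2 : |c| ≤ σmax + τ + δ := by
        have h3 := abs_le.1 (hupper c f g h)
        rw [abs_le]
        constructor <;> linarith
      rw [Polynomial.eval_comp, Polynomial.eval_pow, Polynomial.eval_X]
      refine hq _ ?_ ?_ <;> rw [← sq_abs c] <;> gcongr
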